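/- Let $d\ge 2$, let $\zeta\in\mathbb C^\times$ be a primitive $d$-th root of unity, and let $D(B)$ be the Drinfeld double of the Taft algebra $B$ of dimension $d^2$ (generated by $K,E$ with $K^d=1$, $E^d=0$, $KE=\zeta EK$). Explicitly, $D(B)$ is the Hopf algebra over $\mathbb C$ with generators $E,F,K,z$ and relations $$K^d=z^d=1,\quad E^d=F^d=0,\quad z \text{ central},\quad KE=\zeta EK,\quad KF=\zeta^{-1}FK,\quad EF-FE=K-zK^{-1},$$ with $\Delta(K)=K\otimes K$, $\Delta(z)=z\otimes z$, $\Delta(E)=1\otimes E+E\otimes K$, $\Delta(F)=F\otimes 1+zK^{-1}\otimes F$, with counit $\varepsilon(K)=\varepsilon(z)=1$, $\varepsilon(E)=\varepsilon(F)=0$, and with antipode $S(K)=K^{-1}$, $S(z)=z^{-1}$, $S(E)=-EK^{-1}$, $S(F)=-\zeta^{-1}FKz^{-1}$. Write $(n)_\zeta=1+\zeta+\cdots+\zeta^{n-1}$ and $(n)!_\zeta=\prod_{i=1}^n(i)_\zeta$, put $K^*=Kz^{-1}$, $E^*=\zeta^{-1}FK^*$, and let $$R=\sum_{i,j=0}^{d-1}E^iK^j\otimes\beta_{i,j},\qquad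 \beta_{i,j}=\frac{(E^*)^i}{d\,(i)!_\zeta}\sum_{k=0}^{d-1}\zeta^{-k(i+j)}(K^*)^k ,$$ be the universal $R$-matrix of $D(B)$. The category of finite-dimensional left $D(B)$-modules is braided by $c_{M,N}(m\otimes n)=\tau(R)(n\otimes m)$, where $\tau(a\otimes b)=b\otimes a$, and it is endowed with the pivotal structure whose pivot is $z^{-1}K$, that is, $a_M:M\to M^{**}$, $a_M(m)(\varphi)=\varphi(z^{-1}Km)$. Its quantum traces are $$\mathrm{Tr}_+(f)=\mathrm{ev}_{M^*}\circ(a_Mf\otimes\mathrm{Id}_{M^*})\circ\mathrm{coev}_M,\qquad \mathrm{Tr}_-(f)=\mathrm{ev}_M\circ(\mathrm{Id}_{M^*}\otimes fa_M^{-1})\circ\mathrm{coev}_{M^*},$$ that is, $\mathrm{Tr}_+(f)$ is the usual trace of $z^{-1}Kf$ and $\mathrm{Tr}_-(f)$ the usual trace of $fK^{-1}z$. Let $\mathrm{Gr}(D(B))$ be the Grothendieck ring of this category. For $(i,j)\in\mathbb Z/d\times\mathbb Z/d$ let $\chi_{i,j}:\mathrm{Gr}(D(B))\to\mathbb C$ be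 the ring morphism sending $[M]$ to the usual trace of $K^iz^j$ on $M$. For $\lambda=(l,p)\in\mathbb Z/d\times\mathbb Z/d$, with $l$ represented in $\{1,\dots,d\}$, let $M_\lambda$ be the simple $D(B)$-module with basis $e_1,\dots,e_l$ such that $$z e_i=\zeta^{2p+l-1}e_i,\quad Ke_i=\zeta^{p+l-i}e_i,\quad Ee_{i+1}=\zeta^p(i)_\zeta(\zeta^{l-i}-1)e_i\ (1\le i<l),\ Ee_1=0,\quad Fe_i=e_{i+1}\ (1\le i<l),\ Fe_l=0 .$$ Define additive maps $s^\pm_{M_\lambda}$ from $\mathrm{Gr}(D(B))$ to the endomorphisms of $M_\lambda$ by $$s^+_{M_\lambda}([M])=(\mathrm{Id}_{M_\lambda}\otimes \mathrm{Tr}_+^M)(c_{M,M_\lambda}c_{M_\lambda,M}),\qquad s^-_{M_\lambda}([M])=(\mathrm{Tr}_-^M\otimes\mathrm{Id}_{M_\lambda})(c_{M_\lambda,M}c_{M,M_\lambda}).$$ **Theorem.** For every $\lambda\in\mathbb Z/d\times\mathbb Z/d$, after identifying a scalar with the corresponding multiple of $\mathrm{Id}_{M_\lambda}$, $$s^+_{M_\lambda}=\chi_{-\lambda}\qquad\text{and}\qquad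 s^-_{M_\lambda}=\chi_{(0,1)-\lambda}.$$ -/

import Mathlib

open scoped TensorProduct

namespace DrinfeldTaft

/-! ## Finite-dimensional modules -/

/-- A finite-dimensional left module over a complex algebra `H`: a finite-dimensional complex
vector space `V` with an action `ρ` of `H` by linear endomorphisms. -/
structure FDMod (H : Type) [Ring H] [Algebra ℂ H] where
  V : Type
  [addCommGroup : AddCommGroup V]
  [module : Module ℂ V]
  [finite : FiniteDimensional ℂ V]
  ρ : H →ₐ[ℂ] Module.End ℂ V

attribute [instance] FDMod.addCommGroup FDMod.module FDMod.finite

namespace FDMod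

section Algebra
variable {H : Type} [Ring H] [Algebra ℂ H]

/-- There is a short exact sequence `0 → M' → M → M'' → 0` of `H`-modules. -/
def ShortExact (M' M M'' : FDMod H) : Prop :=
  ∃ (f : M'.V →ₗ[ℂ] M.V) (g : M.V →ₗ[ℂ] M''.V),
    (∀ a : H, f ∘ₗ M'.ρ a = M.ρ a ∘ₗ f) ∧ (∀ a : H, g ∘ₗ M.ρ a = M''.ρ a ∘ₗ g) ∧
    Function.Injective f ∧ Function.Exact f g ∧ Function.Surjective g

theorem trace_of_exact {V' V V'' : Type} [AddCommGroup V'] [Module ℂ V'] [FiniteDimensional ℂ V']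
    [AddCommGroup V] [Module ℂ V] [FiniteDimensional ℂ V]
    [AddCommGroup V''] [Module ℂ V''] [FiniteDimensional ℂ V'']
    (f : V' →ₗ[ℂ] V) (g : V →ₗ[ℂ] V'') (hf : Function.Injective f) (hfg : Function.Exact f g)
    (hg : Function.Surjective g) (a' : Module.End ℂ V') (a : Module.End ℂ V)
    (a'' : Module.End ℂ V'') (h1 : f ∘ₗ a' = a ∘ₗ f) (h2 : g ∘ₗ a = a'' ∘ₗ g) :
    LinearMap.trace ℂ V a = LinearMap.trace ℂ V' a' + LinearMap.trace ℂ V'' a'' := by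
  obtain ⟨r, hr⟩ := f.exists_leftInverse_of_injective (LinearMap.ker_eq_bot.2 hf)
  obtain ⟨s, hs⟩ := g.exists_rightInverse_of_surjective (LinearMap.range_eq_top.2 hg)
  -- the projection `p = f r` and the projection `1 - p`, which factors through `g`
  have hk : ∀ x, ∃ y, x = f y + s (g x) := by
    intro x
    have : g (x - s (g x)) = 0 := by
      rw [map_sub, sub_eq_zero]; exact (LinearMap.congr_fun hs (g x)).symm
    obtain ⟨y, hy⟩ := (hfg _).1 this
    exact ⟨y, by rw [hy]; abel⟩
  have hgf : ∀ y, g (f y) = 0 := fun y => (hfg _).2 ⟨y, rfl⟩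
  have hrf : ∀ y, r (f y) = y := fun y => LinearMap.congr_fun hr y
  have hgs : ∀ y, g (s y) = y := fun y => LinearMap.congr_fun hs y
  let s' : V'' →ₗ[ℂ] V := s - f ∘ₗ r ∘ₗ s
  have hid : f ∘ₗ r + s' ∘ₗ g = LinearMap.id := by
    ext x
    obtain ⟨y, hy⟩ := hk x
    have e : r x = y + r (s (g x)) := by
      conv_lhs => rw [hy]
      rw [map_add, hrf]
    simp only [s', LinearMap.add_apply, LinearMap.comp_apply, LinearMap.sub_apply, e, map_add,
      LinearMap.id_apply]
    conv_rhs => rw [hy]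
    abel
  have e1 : r ∘ₗ a ∘ₗ f = a' := by
    rw [← h1, ← LinearMap.comp_assoc, hr, LinearMap.id_comp]
  have e2 : g ∘ₗ a ∘ₗ s' = a'' := by
    ext x
    have := LinearMap.congr_fun h2 (s' x)
    simp only [LinearMap.comp_apply] at this ⊢
    rw [this]
    simp [s', hgf, hgs]
  calc LinearMap.trace ℂ V a = LinearMap.trace ℂ V (a ∘ₗ (f ∘ₗ r + s' ∘ₗ g)) := by
        rw [hid, LinearMap.comp_id]
    _ = LinearMap.trace ℂ V ((a ∘ₗ f) ∘ₗ r) + LinearMap.trace ℂ V ((a ∘ₗ s') ∘ₗ g) := by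
        rw [LinearMap.comp_add, map_add, LinearMap.comp_assoc, LinearMap.comp_assoc]
    _ = _ := by
        rw [LinearMap.trace_comp_comm' r (a ∘ₗ f), LinearMap.trace_comp_comm' g (a ∘ₗ s'), e1, e2]

theorem ShortExact.trace {M' M M'' : FDMod H} (h : ShortExact M' M M'') (a : H) :
    LinearMap.trace ℂ _ (M.ρ a) = LinearMap.trace ℂ _ (M'.ρ a)
      + LinearMap.trace ℂ _ (M''.ρ a) := by
  obtain ⟨f, g, hf, hg, h1, h2, h3⟩ := h
  exact trace_of_exact f g h1 h2 h3 _ _ _ (hf a) (hg a)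

end Algebra
end FDMod

section Action
variable {H : Type} [Ring H] [Algebra ℂ H]
variable {V W U : Type} [AddCommGroup V] [Module ℂ V] [AddCommGroup W] [Module ℂ W]
  [AddCommGroup U] [Module ℂ U]

/-- The action of `H ⊗ H` on the tensor product of two `H`-modules:
`(a ⊗ b) (v ⊗ w) = a v ⊗ b w`. -/
noncomputable def act₂ (ρ : H →ₐ[ℂ] Module.End ℂ V) (σ : H →ₐ[ℂ] Module.End ℂ W) :
    H ⊗[ℂ] H →ₐ[ℂ] Module.End ℂ (V ⊗[ℂ] W) :=
  (Module.endTensorEndAlgHom (R := ℂ) (S := ℂ) (A := ℂ) (M := V) (N := W)).comp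
    (Algebra.TensorProduct.map ρ σ)

theorem act₂_tmul (ρ : H →ₐ[ℂ] Module.End ℂ V) (σ : H →ₐ[ℂ] Module.End ℂ W) (a b : H) :
    act₂ ρ σ (a ⊗ₜ b) = TensorProduct.map (ρ a) (σ b) := by
  simp [act₂]; rfl

theorem act₂_rTensor {ρ' : H →ₐ[ℂ] Module.End ℂ U} {ρ : H →ₐ[ℂ] Module.End ℂ V}
    (σ : H →ₐ[ℂ] Module.End ℂ W) {f : U →ₗ[ℂ] V}
    (hf : ∀ a : H, f ∘ₗ ρ' a = ρ a ∘ₗ f) (t : H ⊗[ℂ] H) :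
    f.rTensor W ∘ₗ act₂ ρ' σ t = act₂ ρ σ t ∘ₗ f.rTensor W := by
  induction t using TensorProduct.induction_on with
  | zero => simp
  | add x y hx hy => rw [map_add, map_add, LinearMap.comp_add, LinearMap.add_comp, hx, hy]
  | tmul a b =>
    rw [act₂_tmul, act₂_tmul, LinearMap.rTensor, ← TensorProduct.map_comp,
      ← TensorProduct.map_comp, hf, LinearMap.id_comp, LinearMap.comp_id]

theorem act₂_lTensor (ρ : H →ₐ[ℂ] Module.End ℂ V) {σ' : H →ₐ[ℂ] Module.End ℂ U}
    {σ : H →ₐ[ℂ] Module.End ℂ W} {f : U →ₗ[ℂ] W}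
    (hf : ∀ a : H, f ∘ₗ σ' a = σ a ∘ₗ f) (t : H ⊗[ℂ] H) :
    f.lTensor V ∘ₗ act₂ ρ σ' t = act₂ ρ σ t ∘ₗ f.lTensor V := by
  induction t using TensorProduct.induction_on with
  | zero => simp
  | add x y hx hy => rw [map_add, map_add, LinearMap.comp_add, LinearMap.add_comp, hx, hy]
  | tmul a b =>
    rw [act₂_tmul, act₂_tmul, LinearMap.lTensor, ← TensorProduct.map_comp,
      ← TensorProduct.map_comp, hf, LinearMap.id_comp, LinearMap.comp_id]

end Action

section ActionTensor
variable {H : Type} [Ring H] [Bialgebra ℂ H]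
variable {V W U : Type} [AddCommGroup V] [Module ℂ V] [AddCommGroup W] [Module ℂ W]
  [AddCommGroup U] [Module ℂ U]
variable (ρ : H →ₐ[ℂ] Module.End ℂ V) (σ : H →ₐ[ℂ] Module.End ℂ W) (τ : H →ₐ[ℂ] Module.End ℂ U)

/-- The action of `H` on a tensor product of two `H`-modules, through the comultiplication. -/
noncomputable def actTensor : H →ₐ[ℂ] Module.End ℂ (V ⊗[ℂ] W) :=
  (act₂ ρ σ).comp (Bialgebra.comulAlgHom ℂ H)

variable (H) in
/-- The action of `H` on `ℂ` through the counit. -/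
noncomputable def actUnit : H →ₐ[ℂ] Module.End ℂ ℂ :=
  (Algebra.lmul ℂ ℂ).comp (Bialgebra.counitAlgHom ℂ H)

theorem actTensor_apply (a : H) : actTensor ρ σ a = act₂ ρ σ (Coalgebra.comul a) := rfl

theorem actUnit_apply (a : H) (c : ℂ) : actUnit H a c = Coalgebra.counit (R := ℂ) a * c := rfl

/-- The action of `H ⊗ (H ⊗ H)` on a triple tensor product. -/
noncomputable def act₃ : H ⊗[ℂ] (H ⊗[ℂ] H) →ₗ[ℂ] Module.End ℂ (V ⊗[ℂ] (W ⊗[ℂ] U)) :=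
  TensorProduct.homTensorHomMap (.id ℂ) V (W ⊗[ℂ] U) V (W ⊗[ℂ] U) ∘ₗ
    TensorProduct.map ρ.toLinearMap (act₂ σ τ).toLinearMap

theorem act₃_tmul (a : H) (t : H ⊗[ℂ] H) :
    act₃ ρ σ τ (a ⊗ₜ t) = TensorProduct.map (ρ a) (act₂ σ τ t) := by
  simp [act₃]

theorem act₂_actTensor (t : H ⊗[ℂ] H) :
    act₂ ρ (actTensor σ τ) t = act₃ ρ σ τ ((Coalgebra.comul (R := ℂ) (A := H)).lTensor H t) := by
  induction t using TensorProduct.induction_on with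
  | zero => simp
  | add x y hx hy => rw [map_add, map_add, map_add, hx, hy]
  | tmul a b => rw [act₂_tmul, LinearMap.lTensor_tmul, act₃_tmul, actTensor_apply]

theorem assoc_act₂ (t : H ⊗[ℂ] H) :
    (TensorProduct.assoc ℂ V W U).toLinearMap ∘ₗ act₂ (actTensor ρ σ) τ t
      = act₃ ρ σ τ (TensorProduct.assoc ℂ H H H
          ((Coalgebra.comul (R := ℂ) (A := H)).rTensor H t)) ∘ₗ
        (TensorProduct.assoc ℂ V W U).toLinearMap := by
  induction t using TensorProduct.induction_on with
  | zero => rw [map_zero, map_zero, map_zero, map_zero, LinearMap.comp_zero, LinearMap.zero_comp]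
  | add x y hx hy =>
    rw [map_add, map_add, map_add, map_add, LinearMap.comp_add, LinearMap.add_comp, hx, hy]
  | tmul a c =>
    rw [act₂_tmul, LinearMap.rTensor_tmul, actTensor_apply]
    induction (Coalgebra.comul (R := ℂ) a) using TensorProduct.induction_on with
    | zero =>
      rw [map_zero, TensorProduct.zero_tmul, map_zero, map_zero, TensorProduct.map_zero_left,
        LinearMap.comp_zero, LinearMap.zero_comp]
    | add x y hx hy =>
      rw [map_add, TensorProduct.add_tmul, map_add, map_add, TensorProduct.map_add_left,
        LinearMap.comp_add, LinearMap.add_comp, hx, hy]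
    | tmul a b =>
      rw [act₂_tmul, TensorProduct.assoc_tmul, act₃_tmul, act₂_tmul]
      refine TensorProduct.ext_threefold fun x y w => ?_
      simp

theorem assoc_actTensor (a : H) :
    (TensorProduct.assoc ℂ V W U).toLinearMap ∘ₗ actTensor (actTensor ρ σ) τ a
      = actTensor ρ (actTensor σ τ) a ∘ₗ (TensorProduct.assoc ℂ V W U).toLinearMap := by
  rw [actTensor_apply, actTensor_apply, assoc_act₂, act₂_actTensor, Coalgebra.coassoc_apply]

theorem lid_actTensor (a : H) :
    (TensorProduct.lid ℂ V).toLinearMap ∘ₗ actTensor (actUnit H) ρ a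
      = ρ a ∘ₗ (TensorProduct.lid ℂ V).toLinearMap := by
  have key : ∀ t : H ⊗[ℂ] H,
      (TensorProduct.lid ℂ V).toLinearMap ∘ₗ act₂ (actUnit H) ρ t
      = ρ (TensorProduct.lid ℂ H ((Coalgebra.counit (R := ℂ) (A := H)).rTensor H t)) ∘ₗ
        (TensorProduct.lid ℂ V).toLinearMap := by
    intro t
    induction t using TensorProduct.induction_on with
    | zero => simp
    | add x y hx hy => simp only [map_add, LinearMap.comp_add, LinearMap.add_comp, hx, hy]
    | tmul a b =>
      rw [act₂_tmul]
      refine TensorProduct.ext' fun c m => ?_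
      simp [actUnit_apply, mul_smul]
  rw [actTensor_apply, key, Coalgebra.rTensor_counit_comul]
  simp

theorem rid_actTensor (a : H) :
    (TensorProduct.rid ℂ V).toLinearMap ∘ₗ actTensor ρ (actUnit H) a
      = ρ a ∘ₗ (TensorProduct.rid ℂ V).toLinearMap := by
  have key : ∀ t : H ⊗[ℂ] H,
      (TensorProduct.rid ℂ V).toLinearMap ∘ₗ act₂ ρ (actUnit H) t
      = ρ (TensorProduct.rid ℂ H ((Coalgebra.counit (R := ℂ) (A := H)).lTensor H t)) ∘ₗ
        (TensorProduct.rid ℂ V).toLinearMap := by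
    intro t
    induction t using TensorProduct.induction_on with
    | zero => simp
    | add x y hx hy => simp only [map_add, LinearMap.comp_add, LinearMap.add_comp, hx, hy]
    | tmul a b =>
      rw [act₂_tmul]
      refine TensorProduct.ext' fun c m => ?_
      simp [actUnit_apply, mul_smul]
  rw [actTensor_apply, key, Coalgebra.lTensor_counit_comul]
  simp

end ActionTensor

namespace FDMod

section Bialgebra
variable {H : Type} [Ring H] [Bialgebra ℂ H]

/-- The tensor product of two `H`-modules, with the action through the comultiplication. -/
noncomputable def tensor (M N : FDMod H) : FDMod H where
  V := M.V ⊗[ℂ] N.V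
  ρ := actTensor M.ρ N.ρ

variable (H) in
/-- The trivial `H`-module, given by the counit. -/
noncomputable def unit : FDMod H where
  V := ℂ
  ρ := actUnit H

theorem ShortExact.tensor_right {M' M M'' : FDMod H} (h : ShortExact M' M M'') (N : FDMod H) :
    ShortExact (tensor M' N) (tensor M N) (tensor M'' N) := by
  obtain ⟨f, g, hf, hg, h1, h2, h3⟩ := h
  exact ⟨f.rTensor N.V, g.rTensor N.V, fun a => act₂_rTensor N.ρ hf _,
    fun a => act₂_rTensor N.ρ hg _,
    Module.Flat.rTensor_preserves_injective_linearMap f h1, rTensor_exact N.V h2 h3,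
    LinearMap.rTensor_surjective N.V h3⟩

theorem ShortExact.tensor_left {N' N N'' : FDMod H} (h : ShortExact N' N N'') (M : FDMod H) :
    ShortExact (tensor M N') (tensor M N) (tensor M N'') := by
  obtain ⟨f, g, hf, hg, h1, h2, h3⟩ := h
  exact ⟨f.lTensor M.V, g.lTensor M.V, fun a => act₂_lTensor M.ρ hf _,
    fun a => act₂_lTensor M.ρ hg _,
    Module.Flat.lTensor_preserves_injective_linearMap f h1, lTensor_exact M.V h2 h3,
    LinearMap.lTensor_surjective M.V h3⟩

end Bialgebra
end FDMod

/-! ## The Grothendieck ring -/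

section Grothendieck
variable (H : Type) [Ring H] [Bialgebra ℂ H]

/-- The relations `[M] = [M'] + [M'']` of the Grothendieck group, one for each short exact
sequence `0 → M' → M → M'' → 0`. -/
def grothRel : AddSubgroup (FreeAbelianGroup (FDMod H)) :=
  AddSubgroup.closure {x | ∃ M' M M'' : FDMod H, FDMod.ShortExact M' M M'' ∧
    x = FreeAbelianGroup.of M - FreeAbelianGroup.of M' - FreeAbelianGroup.of M''}

/-- The Grothendieck ring of the category of finite-dimensional `H`-modules. -/
def Groth : Type 1 := FreeAbelianGroup (FDMod H) ⧸ grothRel H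

noncomputable instance : AddCommGroup (Groth H) :=
  inferInstanceAs (AddCommGroup (FreeAbelianGroup (FDMod H) ⧸ grothRel H))

namespace Groth
variable {H}

/-- The class `[M]` of a module. -/
def cls (M : FDMod H) : Groth H := QuotientAddGroup.mk (FreeAbelianGroup.of M)

theorem cls_exact {M' M M'' : FDMod H} (h : FDMod.ShortExact M' M M'') :
    cls M = cls M' + cls M'' := by
  have h1 : FreeAbelianGroup.of M - FreeAbelianGroup.of M' - FreeAbelianGroup.of M''
      ∈ grothRel H := AddSubgroup.subset_closure ⟨M', M, M'', h, rfl⟩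
  have h2 := (QuotientAddGroup.eq_zero_iff _).2 h1
  have h3 : cls M - cls M' - cls M'' = 0 := h2
  rw [sub_sub, sub_eq_zero] at h3
  exact h3

theorem cls_eq {M N : FDMod H} (e : M.V ≃ₗ[ℂ] N.V)
    (he : ∀ a : H, e.toLinearMap ∘ₗ M.ρ a = N.ρ a ∘ₗ e.toLinearMap) : cls M = cls N := by
  let Z : FDMod H := { V := PUnit, ρ :=
    { toFun := fun _ => 0
      map_one' := Subsingleton.elim _ _
      map_mul' := fun _ _ => Subsingleton.elim _ _
      map_zero' := rfl
      map_add' := fun _ _ => Subsingleton.elim _ _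
      commutes' := fun _ => Subsingleton.elim _ _ } }
  have hz : cls Z = 0 := by
    have := cls_exact (M' := Z) (M := Z) (M'' := Z) ⟨0, 0, fun _ => Subsingleton.elim _ _,
      fun _ => Subsingleton.elim _ _, fun _ _ _ => Subsingleton.elim _ _,
      fun x => ⟨fun _ => ⟨x, Subsingleton.elim _ _⟩, fun _ => Subsingleton.elim _ _⟩,
      fun x => ⟨x, Subsingleton.elim _ _⟩⟩
    simpa using this
  have := cls_exact (M' := Z) (M := M) (M'' := N) ⟨0, e.toLinearMap, fun a => by simp, he,
    fun _ _ _ => Subsingleton.elim _ _,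
    fun x => ⟨fun h => ⟨PUnit.unit, (e.map_eq_zero_iff.1 h).symm⟩, fun ⟨y, hy⟩ => by simp [← hy]⟩,
    e.surjective⟩
  rw [this, hz, zero_add]

/-- Additive maps on the Grothendieck group. -/
def lift {A : Type*} [AddCommGroup A] (φ : FDMod H → A)
    (hφ : ∀ M' M M'' : FDMod H, FDMod.ShortExact M' M M'' → φ M = φ M' + φ M'') : Groth H →+ A :=
  QuotientAddGroup.lift (grothRel H) (FreeAbelianGroup.lift φ) (by
    intro x hx
    have hle : grothRel H ≤ (FreeAbelianGroup.lift φ).ker := by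
      refine (AddSubgroup.closure_le _).2 ?_
      rintro _ ⟨M', M, M'', h, rfl⟩
      simp [AddMonoidHom.mem_ker, hφ _ _ _ h]
    exact hle hx)

theorem lift_cls {A : Type*} [AddCommGroup A] (φ : FDMod H → A)
    (hφ : ∀ M' M M'' : FDMod H, FDMod.ShortExact M' M M'' → φ M = φ M' + φ M'') (M : FDMod H) :
    lift φ hφ (cls M) = φ M :=
  FreeAbelianGroup.lift_apply_of φ M

theorem addHom_ext {A : Type*} [AddCommGroup A] {φ ψ : Groth H →+ A}
    (h : ∀ M, φ (cls M) = ψ (cls M)) : φ = ψ :=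
  QuotientAddGroup.addMonoidHom_ext _ (FreeAbelianGroup.lift_ext _ _ h)

/-- The multiplication `[M] [N] = [M ⊗ N]`. -/
noncomputable def mulHom : Groth H →+ Groth H →+ Groth H :=
  lift (fun M => lift (fun N => cls (M.tensor N)) (fun _ _ _ h => cls_exact (h.tensor_left M)))
    (fun _ _ _ h => addHom_ext fun N => by
      rw [AddMonoidHom.add_apply, lift_cls, lift_cls, lift_cls]
      exact cls_exact (h.tensor_right N))

theorem mulHom_cls (M N : FDMod H) : mulHom (cls M) (cls N) = cls (M.tensor N) := by
  rw [mulHom, lift_cls, lift_cls]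

theorem cls_assoc (M N P : FDMod H) :
    cls ((M.tensor N).tensor P) = cls (M.tensor (N.tensor P)) :=
  cls_eq (M := (M.tensor N).tensor P) (N := M.tensor (N.tensor P))
    (TensorProduct.assoc ℂ M.V N.V P.V) (assoc_actTensor M.ρ N.ρ P.ρ)

theorem cls_unit_tensor (M : FDMod H) : cls ((FDMod.unit H).tensor M) = cls M :=
  cls_eq (M := (FDMod.unit H).tensor M) (TensorProduct.lid ℂ M.V) (lid_actTensor M.ρ)

theorem cls_tensor_unit (M : FDMod H) : cls (M.tensor (FDMod.unit H)) = cls M :=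
  cls_eq (M := M.tensor (FDMod.unit H)) (TensorProduct.rid ℂ M.V) (rid_actTensor M.ρ)

theorem induct {P : Groth H → Prop} (hcls : ∀ M, P (cls M)) (hneg : ∀ x, P x → P (-x))
    (hadd : ∀ x y, P x → P y → P (x + y)) (h0 : P 0) (x : Groth H) : P x := by
  obtain ⟨y, rfl⟩ := QuotientAddGroup.mk_surjective x
  induction y using FreeAbelianGroup.induction_on with
  | zero => exact h0
  | of M => exact hcls M
  | neg M h => exact hneg _ h
  | add x y hx hy => exact hadd _ _ hx hy

/-- The ring structure, with `[M] [N] = [M ⊗ N]` and unit the class of the trivial module. -/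
noncomputable instance : Ring (Groth H) :=
  { (inferInstance : AddCommGroup (Groth H)) with
    mul := fun x y => mulHom x y
    one := cls (FDMod.unit H)
    left_distrib := fun x y w => map_add (mulHom x) y w
    right_distrib := fun x y w => by
      change mulHom (x + y) w = mulHom x w + mulHom y w
      rw [map_add, AddMonoidHom.add_apply]
    zero_mul := fun x => by
      change mulHom 0 x = 0
      rw [map_zero, AddMonoidHom.zero_apply]
    mul_zero := fun x => map_zero (mulHom x)
    mul_assoc := fun x y w => by
      change mulHom (mulHom x y) w = mulHom x (mulHom y w)
      refine induct (P := fun x => mulHom (mulHom x y) w = mulHom x (mulHom y w)) (fun M => ?_)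
        (fun x h => ?_) (fun x x' h h' => ?_) ?_ x
      · refine induct (P := fun y => mulHom (mulHom (cls M) y) w = mulHom (cls M) (mulHom y w))
          (fun N => ?_) (fun x h => ?_) (fun x x' h h' => ?_) ?_ y
        · refine induct (P := fun w => mulHom (mulHom (cls M) (cls N)) w
            = mulHom (cls M) (mulHom (cls N) w)) (fun P => ?_) (fun x h => ?_)
            (fun x x' h h' => ?_) ?_ w
          · rw [mulHom_cls, mulHom_cls, mulHom_cls, mulHom_cls, cls_assoc]
          · rw [map_neg, map_neg, map_neg, h]
          · rw [map_add, map_add, map_add, h, h']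
          · rw [map_zero, map_zero, map_zero]
        · simp only [map_neg, AddMonoidHom.neg_apply, h]
        · simp only [map_add, AddMonoidHom.add_apply, h, h']
        · simp only [map_zero, AddMonoidHom.zero_apply]
      · simp only [map_neg, AddMonoidHom.neg_apply, h]
      · simp only [map_add, AddMonoidHom.add_apply, h, h']
      · simp only [map_zero, AddMonoidHom.zero_apply]
    one_mul := fun x => by
      change mulHom (cls (FDMod.unit H)) x = x
      refine induct (P := fun x => mulHom (cls (FDMod.unit H)) x = x) (fun M => ?_)
        (fun x h => ?_) (fun x x' h h' => ?_) ?_ x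
      · rw [mulHom_cls, cls_unit_tensor]
      · rw [map_neg, h]
      · rw [map_add, h, h']
      · rw [map_zero]
    mul_one := fun x => by
      change mulHom x (cls (FDMod.unit H)) = x
      refine induct (P := fun x => mulHom x (cls (FDMod.unit H)) = x) (fun M => ?_)
        (fun x h => ?_) (fun x x' h h' => ?_) ?_ x
      · rw [mulHom_cls, cls_tensor_unit]
      · rw [map_neg, AddMonoidHom.neg_apply, h]
      · rw [map_add, AddMonoidHom.add_apply, h, h']
      · rw [map_zero, AddMonoidHom.zero_apply] }

theorem cls_mul (M N : FDMod H) : cls M * cls N = cls (M.tensor N) := mulHom_cls M N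
theorem one_def : (1 : Groth H) = cls (FDMod.unit H) := rfl

/-- The additive map `[M] ↦ Tr(b|_M)` given by an element `b`. -/
noncomputable def traceHom (b : H) : Groth H →+ ℂ :=
  lift (fun M => LinearMap.trace ℂ M.V (M.ρ b)) (fun _ _ _ h => h.trace b)

theorem traceHom_cls (b : H) (M : FDMod H) :
    traceHom b (cls M) = LinearMap.trace ℂ M.V (M.ρ b) :=
  lift_cls _ _ M

theorem traceHom_one {b : H} (hb : Coalgebra.counit (R := ℂ) b = 1) :
    traceHom b (1 : Groth H) = 1 := by
  have h : actUnit H b = LinearMap.id := by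
    ext
    simp [actUnit_apply, hb]
  rw [one_def, traceHom_cls]
  change LinearMap.trace ℂ ℂ (actUnit H b) = 1
  rw [h, LinearMap.trace_id]
  simp

theorem traceHom_mul {b : H} (hb : Coalgebra.comul (R := ℂ) b = b ⊗ₜ b) (x y : Groth H) :
    traceHom b (x * y) = traceHom b x * traceHom b y := by
  refine induct (P := fun x => traceHom b (x * y) = traceHom b x * traceHom b y) (fun M => ?_)
    (fun x h => ?_) (fun x x' h h' => ?_) ?_ x
  · refine induct (P := fun y => traceHom b (cls M * y) = traceHom b (cls M) * traceHom b y)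
      (fun N => ?_) (fun x h => ?_) (fun x x' h h' => ?_) ?_ y
    · rw [cls_mul, traceHom_cls, traceHom_cls, traceHom_cls]
      change LinearMap.trace ℂ (M.V ⊗[ℂ] N.V) (act₂ M.ρ N.ρ (Coalgebra.comul b)) = _
      rw [hb, act₂_tmul]
      exact LinearMap.trace_tensorProduct' _ _
    · rw [mul_neg, map_neg, h, map_neg, mul_neg]
    · rw [mul_add, map_add, h, h', map_add, mul_add]
    · rw [mul_zero, map_zero, mul_zero]
  · rw [neg_mul, map_neg, h, map_neg, neg_mul]
  · rw [add_mul, map_add, h, h', map_add, add_mul]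
  · rw [zero_mul, map_zero, zero_mul]

/-- The character `[M] ↦ Tr(b|_M)` of the Grothendieck ring given by a group-like element `b`. -/
noncomputable def traceChar (b : H) (hb : IsGroupLikeElem ℂ b) : Groth H →+* ℂ :=
  { traceHom b with
    map_one' := traceHom_one hb.counit_eq_one
    map_mul' := traceHom_mul hb.comul_eq_tmul_self }

theorem traceChar_cls (b : H) (hb : IsGroupLikeElem ℂ b) (M : FDMod H) :
    traceChar b hb (cls M) = LinearMap.trace ℂ M.V (M.ρ b) :=
  traceHom_cls b M

end Groth
end Grothendieck

/-! ## Braiding, quantum traces, and the maps `s^±` -/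

section PartialTrace
variable {V X : Type} [AddCommGroup V] [Module ℂ V] [FiniteDimensional ℂ V]
  [AddCommGroup X] [Module ℂ X]

open Module in
/-- The right partial trace `(id_X ⊗ Tr_+)(f)` of an endomorphism `f` of `X ⊗ V`, for a pivotal
structure `a : V → V**`:
`X → X ⊗ (V ⊗ V*) → (X ⊗ V) ⊗ V* → (X ⊗ V) ⊗ V* → X ⊗ (V ⊗ V*) → X ⊗ (V** ⊗ V*) → X`,
through the coevaluation of `V`, `f`, `a` and the evaluation of `V*`. -/
noncomputable def rightTr (a : V ≃ₗ[ℂ] Dual ℂ (Dual ℂ V)) (f : Module.End ℂ (X ⊗[ℂ] V)) :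
    Module.End ℂ X :=
  (TensorProduct.rid ℂ X).toLinearMap ∘ₗ
  (contractLeft ℂ (Dual ℂ V)).lTensor X ∘ₗ
  (a.toLinearMap.rTensor (Dual ℂ V)).lTensor X ∘ₗ
  (TensorProduct.assoc ℂ X V (Dual ℂ V)).toLinearMap ∘ₗ
  f.rTensor (Dual ℂ V) ∘ₗ
  (TensorProduct.assoc ℂ X V (Dual ℂ V)).symm.toLinearMap ∘ₗ
  (coevaluation ℂ V).lTensor X ∘ₗ
  (TensorProduct.rid ℂ X).symm.toLinearMap

open Module in
/-- The left partial trace `(Tr_- ⊗ id_X)(f)` of an endomorphism `f` of `V ⊗ X`, for a pivotal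
structure `a : V → V**`:
`X → (V* ⊗ V**) ⊗ X → V* ⊗ (V** ⊗ X) → V* ⊗ (V ⊗ X) → V* ⊗ (V ⊗ X) → (V* ⊗ V) ⊗ X → X`,
through the coevaluation of `V*`, the inverse of `a`, `f` and the evaluation of `V`. -/
noncomputable def leftTr (a : V ≃ₗ[ℂ] Dual ℂ (Dual ℂ V)) (f : Module.End ℂ (V ⊗[ℂ] X)) :
    Module.End ℂ X :=
  (TensorProduct.lid ℂ X).toLinearMap ∘ₗ
  (contractLeft ℂ V).rTensor X ∘ₗ
  (TensorProduct.assoc ℂ (Dual ℂ V) V X).symm.toLinearMap ∘ₗ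
  f.lTensor (Dual ℂ V) ∘ₗ
  (a.symm.toLinearMap.rTensor X).lTensor (Dual ℂ V) ∘ₗ
  (TensorProduct.assoc ℂ (Dual ℂ V) (Dual ℂ (Dual ℂ V)) X).toLinearMap ∘ₗ
  (coevaluation ℂ (Dual ℂ V)).rTensor X ∘ₗ
  (TensorProduct.lid ℂ X).symm.toLinearMap

variable (a : V ≃ₗ[ℂ] Module.Dual ℂ (Module.Dual ℂ V))

theorem rightTr_zero : rightTr a (0 : Module.End ℂ (X ⊗[ℂ] V)) = 0 := by
  simp [rightTr]

theorem rightTr_add (f g : Module.End ℂ (X ⊗[ℂ] V)) :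
    rightTr a (f + g) = rightTr a f + rightTr a g := by
  simp only [rightTr, LinearMap.rTensor_add, LinearMap.comp_add, LinearMap.add_comp]

theorem leftTr_zero : leftTr a (0 : Module.End ℂ (V ⊗[ℂ] X)) = 0 := by
  simp [leftTr]

theorem leftTr_add (f g : Module.End ℂ (V ⊗[ℂ] X)) :
    leftTr a (f + g) = leftTr a f + leftTr a g := by
  simp only [leftTr, LinearMap.lTensor_add, LinearMap.comp_add, LinearMap.add_comp]

theorem rightTr_map (A : Module.End ℂ X) (B : Module.End ℂ V) (G : V ≃ₗ[ℂ] V) :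
    rightTr (G ≪≫ₗ Module.evalEquiv ℂ V) (TensorProduct.map A B)
      = LinearMap.trace ℂ V (G.toLinearMap ∘ₗ B) • A := by
  classical
  ext x
  rw [LinearMap.trace_eq_matrix_trace ℂ (Module.Basis.ofVectorSpace ℂ V)]
  simp [rightTr, coevaluation_apply_one, TensorProduct.tmul_sum, Matrix.trace, Finset.sum_smul,
    LinearMap.toMatrix_apply]

theorem leftTr_map (A : Module.End ℂ X) (B : Module.End ℂ V) (G : V ≃ₗ[ℂ] V) :
    leftTr (G ≪≫ₗ Module.evalEquiv ℂ V) (TensorProduct.map B A)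
      = LinearMap.trace ℂ V (B ∘ₗ G.symm.toLinearMap) • A := by
  classical
  ext x
  rw [← LinearMap.trace_transpose',
    LinearMap.trace_eq_matrix_trace ℂ (Module.Basis.ofVectorSpace ℂ (Module.Dual ℂ V))]
  have key : ∀ (φ : Module.Dual ℂ V) (ψ : Module.Dual ℂ (Module.Dual ℂ V)),
      φ (B (G.symm ((Module.evalEquiv ℂ V).symm ψ)))
        = ψ (Module.Dual.transpose (R := ℂ) (B ∘ₗ G.symm.toLinearMap) φ) := by
    intro φ ψ
    obtain ⟨v, rfl⟩ := (Module.evalEquiv ℂ V).surjective ψ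
    rw [LinearEquiv.symm_apply_apply]
    rfl
  simp [leftTr, coevaluation_apply_one, TensorProduct.sum_tmul, Matrix.trace, Finset.sum_smul,
    LinearMap.toMatrix_apply, key]

end PartialTrace

namespace FDMod
section
variable {H : Type} [Ring H] [Algebra ℂ H]

/-- The braiding given by `R = ∑ aᵢ ⊗ bᵢ`: `c_{M,N}(m ⊗ n) = τ(R) (n ⊗ m) = ∑ bᵢ n ⊗ aᵢ m`. -/
noncomputable def braiding (R : H ⊗[ℂ] H) (M N : FDMod H) :
    M.V ⊗[ℂ] N.V →ₗ[ℂ] N.V ⊗[ℂ] M.V :=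
  act₂ N.ρ M.ρ (TensorProduct.comm ℂ H H R) ∘ₗ (TensorProduct.comm ℂ M.V N.V).toLinearMap

/-- The double braiding `c_{N,M} ∘ c_{M,N}`, an endomorphism of `M ⊗ N`. -/
noncomputable def doubleBraiding (R : H ⊗[ℂ] H) (M N : FDMod H) :
    Module.End ℂ (M.V ⊗[ℂ] N.V) :=
  braiding R N M ∘ₗ braiding R M N

/-- The automorphism of the vector space `M` by which a unit `g` acts. -/
noncomputable def unitEquiv (g : Hˣ) (M : FDMod H) : M.V ≃ₗ[ℂ] M.V :=
  LinearMap.GeneralLinearGroup.generalLinearEquiv ℂ M.V (Units.map (M.ρ : H →* Module.End ℂ M.V) g)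

/-- The pivotal structure `a_M : M → M**` with pivot `g`: `a_M(m)(φ) = φ(g m)`. -/
noncomputable def pivotal (g : Hˣ) (M : FDMod H) :
    M.V ≃ₗ[ℂ] Module.Dual ℂ (Module.Dual ℂ M.V) :=
  unitEquiv g M ≪≫ₗ Module.evalEquiv ℂ M.V

theorem pivotal_apply (g : Hˣ) (M : FDMod H) (m : M.V) (φ : Module.Dual ℂ M.V) :
    pivotal g M m φ = φ (M.ρ g m) := rfl

theorem comm_act₂ (M N : FDMod H) (t : H ⊗[ℂ] H) :
    (TensorProduct.comm ℂ M.V N.V).toLinearMap ∘ₗ act₂ M.ρ N.ρ t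
      = act₂ N.ρ M.ρ (TensorProduct.comm ℂ H H t) ∘ₗ
        (TensorProduct.comm ℂ M.V N.V).toLinearMap := by
  induction t using TensorProduct.induction_on with
  | zero => simp
  | add x y hx hy => simp only [map_add, LinearMap.comp_add, LinearMap.add_comp, hx, hy]
  | tmul a b =>
    rw [act₂_tmul, TensorProduct.comm_tmul, act₂_tmul]
    exact TensorProduct.ext' fun x y => by simp

theorem doubleBraiding_eq (R : H ⊗[ℂ] H) (M N : FDMod H) :
    doubleBraiding R M N = act₂ M.ρ N.ρ (TensorProduct.comm ℂ H H R * R) := by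
  have h := comm_act₂ N M (TensorProduct.comm ℂ H H R)
  have h2 : TensorProduct.comm ℂ H H (TensorProduct.comm ℂ H H R) = R := by
    clear h
    induction R using TensorProduct.induction_on with
    | zero => simp
    | add x y hx hy => rw [map_add, map_add, hx, hy]
    | tmul a b => rfl
  rw [h2] at h
  rw [doubleBraiding, braiding, braiding, LinearMap.comp_assoc, ← LinearMap.comp_assoc _ _
    (TensorProduct.comm ℂ N.V M.V).toLinearMap, h, LinearMap.comp_assoc, map_mul]
  have h3 : (TensorProduct.comm ℂ N.V M.V).toLinearMap ∘ₗ
      (TensorProduct.comm ℂ M.V N.V).toLinearMap = LinearMap.id :=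
    TensorProduct.ext' fun x y => by simp
  rw [h3, LinearMap.comp_id]
  rfl

theorem rightTr_act₂_exact (g : Hˣ) (X : FDMod H) {M' M M'' : FDMod H}
    (h : ShortExact M' M M'') (t : H ⊗[ℂ] H) :
    rightTr (pivotal g M) (act₂ X.ρ M.ρ t)
      = rightTr (pivotal g M') (act₂ X.ρ M'.ρ t) + rightTr (pivotal g M'') (act₂ X.ρ M''.ρ t) := by
  induction t using TensorProduct.induction_on with
  | zero => simp only [map_zero, rightTr_zero, add_zero]
  | add x y hx hy => simp only [map_add, rightTr_add, hx, hy]; abel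
  | tmul a b =>
    have key : ∀ N : FDMod H, rightTr (pivotal g N) (act₂ X.ρ N.ρ (a ⊗ₜ b))
        = LinearMap.trace ℂ N.V (N.ρ (g * b)) • X.ρ a := by
      intro N
      rw [act₂_tmul, pivotal, rightTr_map, map_mul]
      rfl
    rw [key, key, key, h.trace, add_smul]

theorem leftTr_act₂_exact (g : Hˣ) (X : FDMod H) {M' M M'' : FDMod H}
    (h : ShortExact M' M M'') (t : H ⊗[ℂ] H) :
    leftTr (pivotal g M) (act₂ M.ρ X.ρ t)
      = leftTr (pivotal g M') (act₂ M'.ρ X.ρ t) + leftTr (pivotal g M'') (act₂ M''.ρ X.ρ t) := by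
  induction t using TensorProduct.induction_on with
  | zero => simp only [map_zero, leftTr_zero, add_zero]
  | add x y hx hy => simp only [map_add, leftTr_add, hx, hy]; abel
  | tmul a b =>
    have key : ∀ N : FDMod H, leftTr (pivotal g N) (act₂ N.ρ X.ρ (a ⊗ₜ b))
        = LinearMap.trace ℂ N.V (N.ρ (a * (g⁻¹ : Hˣ))) • X.ρ b := by
      intro N
      rw [act₂_tmul, pivotal, leftTr_map, map_mul]
      rfl
    rw [key, key, key, h.trace, add_smul]

end
end FDMod

section SMaps
variable {H : Type} [Ring H] [Bialgebra ℂ H]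

/-- The map `s_X^+`, `[M] ↦ (id_X ⊗ Tr_+^M)(c_{M,X} ∘ c_{X,M})`, for the braiding given by `R` and
the pivot `g`, on the Grothendieck ring, with values in the endomorphisms of `X`. -/
noncomputable def sPlus (R : H ⊗[ℂ] H) (g : Hˣ) (X : FDMod H) : Groth H →+ Module.End ℂ X.V :=
  Groth.lift (fun M => rightTr (M.pivotal g) (FDMod.doubleBraiding R X M)) (fun M' M M'' h => by
    simp only [FDMod.doubleBraiding_eq]; exact FDMod.rightTr_act₂_exact g X h _)

/-- The map `s_X^-`, `[M] ↦ (Tr_-^M ⊗ id_X)(c_{X,M} ∘ c_{M,X})`, for the braiding given by `R` and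
the pivot `g`, on the Grothendieck ring, with values in the endomorphisms of `X`. -/
noncomputable def sMinus (R : H ⊗[ℂ] H) (g : Hˣ) (X : FDMod H) : Groth H →+ Module.End ℂ X.V :=
  Groth.lift (fun M => leftTr (M.pivotal g) (FDMod.doubleBraiding R M X)) (fun M' M M'' h => by
    simp only [FDMod.doubleBraiding_eq]; exact FDMod.leftTr_act₂_exact g X h _)

theorem sPlus_cls (R : H ⊗[ℂ] H) (g : Hˣ) (X M : FDMod H) :
    sPlus R g X (Groth.cls M) = rightTr (M.pivotal g) (FDMod.doubleBraiding R X M) :=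
  Groth.lift_cls _ _ M

theorem sMinus_cls (R : H ⊗[ℂ] H) (g : Hˣ) (X M : FDMod H) :
    sMinus R g X (Groth.cls M) = leftTr (M.pivotal g) (FDMod.doubleBraiding R M X) :=
  Groth.lift_cls _ _ M

end SMaps

/-! ## The Drinfeld double of the Taft algebra -/

section Double

/-- The four generators of the algebra `D(B)`. -/
inductive Gen : Type
  | E | F | K | z

/-- The defining relations of `D(B)`; since `K ^ d = 1`, the inverse of `K` is `K ^ (d - 1)`. -/
inductive Rel (d : ℕ) (ζ : ℂ) : FreeAlgebra ℂ Gen → FreeAlgebra ℂ Gen → Prop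
  | K_pow : Rel d ζ (FreeAlgebra.ι ℂ Gen.K ^ d) 1
  | z_pow : Rel d ζ (FreeAlgebra.ι ℂ Gen.z ^ d) 1
  | E_pow : Rel d ζ (FreeAlgebra.ι ℂ Gen.E ^ d) 0
  | F_pow : Rel d ζ (FreeAlgebra.ι ℂ Gen.F ^ d) 0
  | zE : Rel d ζ (FreeAlgebra.ι ℂ Gen.z * FreeAlgebra.ι ℂ Gen.E)
      (FreeAlgebra.ι ℂ Gen.E * FreeAlgebra.ι ℂ Gen.z)
  | zF : Rel d ζ (FreeAlgebra.ι ℂ Gen.z * FreeAlgebra.ι ℂ Gen.F)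
      (FreeAlgebra.ι ℂ Gen.F * FreeAlgebra.ι ℂ Gen.z)
  | zK : Rel d ζ (FreeAlgebra.ι ℂ Gen.z * FreeAlgebra.ι ℂ Gen.K)
      (FreeAlgebra.ι ℂ Gen.K * FreeAlgebra.ι ℂ Gen.z)
  | KE : Rel d ζ (FreeAlgebra.ι ℂ Gen.K * FreeAlgebra.ι ℂ Gen.E)
      (ζ • (FreeAlgebra.ι ℂ Gen.E * FreeAlgebra.ι ℂ Gen.K))
  | KF : Rel d ζ (FreeAlgebra.ι ℂ Gen.K * FreeAlgebra.ι ℂ Gen.F)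
      (ζ⁻¹ • (FreeAlgebra.ι ℂ Gen.F * FreeAlgebra.ι ℂ Gen.K))
  | EF : Rel d ζ (FreeAlgebra.ι ℂ Gen.E * FreeAlgebra.ι ℂ Gen.F
        - FreeAlgebra.ι ℂ Gen.F * FreeAlgebra.ι ℂ Gen.E)
      (FreeAlgebra.ι ℂ Gen.K - FreeAlgebra.ι ℂ Gen.z * FreeAlgebra.ι ℂ Gen.K ^ (d - 1))

/-- The defining relations of `D(B)`, for four elements of an arbitrary algebra. -/
structure Relations (d : ℕ) (ζ : ℂ) {A : Type*} [Ring A] [Algebra ℂ A] (e f k w : A) : Prop where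
  K_pow : k ^ d = 1
  z_pow : w ^ d = 1
  E_pow : e ^ d = 0
  F_pow : f ^ d = 0
  zE : w * e = e * w
  zF : w * f = f * w
  zK : w * k = k * w
  KE : k * e = ζ • (e * k)
  KF : k * f = ζ⁻¹ • (f * k)
  EF : e * f - f * e = k - w * k ^ (d - 1)

variable {d : ℕ} {ζ : ℂ}

/-- The algebra `D(B)`: the Drinfeld double of the Taft algebra `B` attached to the primitive
`d`-th root of unity `ζ`, given by generators and relations. Its Hopf algebra structure is
constructed below. -/
def DB (_hd : 2 ≤ d) (_hζ : IsPrimitiveRoot ζ d) : Type :=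
  RingQuot (Rel d ζ)

variable (hd : 2 ≤ d) (hζ : IsPrimitiveRoot ζ d)

noncomputable instance : Ring (DB hd hζ) := inferInstanceAs (Ring (RingQuot (Rel d ζ)))
noncomputable instance : Algebra ℂ (DB hd hζ) :=
  inferInstanceAs (Algebra ℂ (RingQuot (Rel d ζ)))

namespace DB

/-- The class in `D(B)` of a generator. -/
noncomputable def gen (g : Gen) : DB hd hζ :=
  RingQuot.mkAlgHom ℂ (Rel d ζ) (FreeAlgebra.ι ℂ g)

/-- The generator `E`. -/
noncomputable def E : DB hd hζ := gen hd hζ Gen.E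
/-- The generator `F`. -/
noncomputable def F : DB hd hζ := gen hd hζ Gen.F
/-- The generator `K`. -/
noncomputable def K : DB hd hζ := gen hd hζ Gen.K
/-- The generator `z`. -/
noncomputable def z : DB hd hζ := gen hd hζ Gen.z
/-- The inverse of `K`. -/
noncomputable def Kinv : DB hd hζ := K hd hζ ^ (d - 1)
/-- The inverse of `z`. -/
noncomputable def zinv : DB hd hζ := z hd hζ ^ (d - 1)

theorem rel {x y : FreeAlgebra ℂ Gen} (h : Rel d ζ x y) :
    RingQuot.mkAlgHom ℂ (Rel d ζ) x = RingQuot.mkAlgHom ℂ (Rel d ζ) y :=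
  RingQuot.mkAlgHom_rel ℂ h

theorem K_pow : K hd hζ ^ d = 1 := by
  have h := rel (Rel.K_pow (d := d) (ζ := ζ)); rw [map_pow, map_one] at h; exact h
theorem z_pow : z hd hζ ^ d = 1 := by
  have h := rel (Rel.z_pow (d := d) (ζ := ζ)); rw [map_pow, map_one] at h; exact h
theorem E_pow : E hd hζ ^ d = 0 := by
  have h := rel (Rel.E_pow (d := d) (ζ := ζ)); rw [map_pow, map_zero] at h; exact h
theorem F_pow : F hd hζ ^ d = 0 := by
  have h := rel (Rel.F_pow (d := d) (ζ := ζ)); rw [map_pow, map_zero] at h; exact h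
theorem zE : z hd hζ * E hd hζ = E hd hζ * z hd hζ := by
  have h := rel (Rel.zE (d := d) (ζ := ζ)); rw [map_mul, map_mul] at h; exact h
theorem zF : z hd hζ * F hd hζ = F hd hζ * z hd hζ := by
  have h := rel (Rel.zF (d := d) (ζ := ζ)); rw [map_mul, map_mul] at h; exact h
theorem zK : z hd hζ * K hd hζ = K hd hζ * z hd hζ := by
  have h := rel (Rel.zK (d := d) (ζ := ζ)); rw [map_mul, map_mul] at h; exact h
theorem KE : K hd hζ * E hd hζ = ζ • (E hd hζ * K hd hζ) := by
  have h := rel (Rel.KE (d := d) (ζ := ζ)); rw [map_smul, map_mul, map_mul] at h; exact h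
theorem KF : K hd hζ * F hd hζ = ζ⁻¹ • (F hd hζ * K hd hζ) := by
  have h := rel (Rel.KF (d := d) (ζ := ζ)); rw [map_smul, map_mul, map_mul] at h; exact h
theorem EF : E hd hζ * F hd hζ - F hd hζ * E hd hζ
    = K hd hζ - z hd hζ * Kinv hd hζ := by
  have h := rel (Rel.EF (d := d) (ζ := ζ))
  simp only [map_sub, map_mul, map_pow] at h; exact h

variable {A : Type*} [Ring A] [Algebra ℂ A]

/-- The universal property of the presentation. -/
noncomputable def lift {e f k w : A} (h : Relations d ζ e f k w) : DB hd hζ →ₐ[ℂ] A :=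
  RingQuot.liftAlgHom ℂ (s := Rel d ζ)
    ⟨FreeAlgebra.lift ℂ (fun g : Gen => match g with
        | Gen.E => e | Gen.F => f | Gen.K => k | Gen.z => w), by
      intro x y hxy
      cases hxy <;> simp [h.K_pow, h.z_pow, h.E_pow, h.F_pow, h.zE, h.zF, h.zK, h.KE, h.KF, h.EF]⟩

section lift
variable {e f k w : A} (h : Relations d ζ e f k w)
theorem lift_E : lift hd hζ h (E hd hζ) = e := by
  simp only [lift, E, gen]
  exact (RingQuot.liftAlgHom_mkAlgHom_apply ℂ _ _ _).trans (by simp)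
theorem lift_F : lift hd hζ h (F hd hζ) = f := by
  simp only [lift, F, gen]
  exact (RingQuot.liftAlgHom_mkAlgHom_apply ℂ _ _ _).trans (by simp)
theorem lift_K : lift hd hζ h (K hd hζ) = k := by
  simp only [lift, K, gen]
  exact (RingQuot.liftAlgHom_mkAlgHom_apply ℂ _ _ _).trans (by simp)
theorem lift_z : lift hd hζ h (z hd hζ) = w := by
  simp only [lift, z, gen]
  exact (RingQuot.liftAlgHom_mkAlgHom_apply ℂ _ _ _).trans (by simp)
end lift

theorem algHom_ext {φ ψ : DB hd hζ →ₐ[ℂ] A} (hE : φ (E hd hζ) = ψ (E hd hζ))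
    (hF : φ (F hd hζ) = ψ (F hd hζ)) (hK : φ (K hd hζ) = ψ (K hd hζ))
    (hz : φ (z hd hζ) = ψ (z hd hζ)) : φ = ψ := by
  apply RingQuot.ringQuot_ext' ℂ
  apply FreeAlgebra.hom_ext
  funext g
  cases g
  exacts [hE, hF, hK, hz]

theorem K_mul_Kinv : K hd hζ * Kinv hd hζ = 1 := by
  rw [Kinv, mul_pow_sub_one (by omega), K_pow]
theorem Kinv_mul_K : Kinv hd hζ * K hd hζ = 1 := by
  rw [Kinv, pow_sub_one_mul (by omega), K_pow]
theorem z_mul_zinv : z hd hζ * zinv hd hζ = 1 := by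
  rw [zinv, mul_pow_sub_one (by omega), z_pow]
theorem zinv_mul_z : zinv hd hζ * z hd hζ = 1 := by
  rw [zinv, pow_sub_one_mul (by omega), z_pow]

theorem zK_pow (n : ℕ) : z hd hζ * K hd hζ ^ n = K hd hζ ^ n * z hd hζ :=
  (Commute.pow_right (zK hd hζ) n).eq
theorem zKinv : z hd hζ * Kinv hd hζ = Kinv hd hζ * z hd hζ := zK_pow hd hζ _

theorem Kinv_E : Kinv hd hζ * E hd hζ = ζ⁻¹ • (E hd hζ * Kinv hd hζ) := by
  have h0 : ζ ≠ 0 := hζ.ne_zero (by omega)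
  have h : E hd hζ * Kinv hd hζ = ζ • (Kinv hd hζ * E hd hζ) := by
    calc E hd hζ * Kinv hd hζ
        = Kinv hd hζ * (K hd hζ * E hd hζ) * Kinv hd hζ := by
          rw [← mul_assoc, Kinv_mul_K, one_mul]
      _ = ζ • (Kinv hd hζ * E hd hζ * (K hd hζ * Kinv hd hζ)) := by
          rw [KE]; simp only [mul_smul_comm, smul_mul_assoc, mul_assoc]
      _ = _ := by rw [K_mul_Kinv, mul_one]
  rw [h, smul_smul, inv_mul_cancel₀ h0, one_smul]

theorem Kinv_F : Kinv hd hζ * F hd hζ = ζ • (F hd hζ * Kinv hd hζ) := by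
  have h0 : ζ ≠ 0 := hζ.ne_zero (by omega)
  have h : F hd hζ * Kinv hd hζ = ζ⁻¹ • (Kinv hd hζ * F hd hζ) := by
    calc F hd hζ * Kinv hd hζ
        = Kinv hd hζ * (K hd hζ * F hd hζ) * Kinv hd hζ := by
          rw [← mul_assoc, Kinv_mul_K, one_mul]
      _ = ζ⁻¹ • (Kinv hd hζ * F hd hζ * (K hd hζ * Kinv hd hζ)) := by
          rw [KF]; simp only [mul_smul_comm, smul_mul_assoc, mul_assoc]
      _ = _ := by rw [K_mul_Kinv, mul_one]
  rw [h, smul_smul, mul_inv_cancel₀ h0, one_smul]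

theorem induct {P : DB hd hζ → Prop} (hc : ∀ c : ℂ, P (algebraMap ℂ _ c))
    (hE : P (E hd hζ)) (hF : P (F hd hζ)) (hK : P (K hd hζ)) (hz : P (z hd hζ))
    (hmul : ∀ a b, P a → P b → P (a * b)) (hadd : ∀ a b, P a → P b → P (a + b))
    (a : DB hd hζ) : P a := by
  obtain ⟨x, hx⟩ := RingQuot.mkAlgHom_surjective ℂ (Rel d ζ) a
  rw [← hx]
  clear hx
  induction x using FreeAlgebra.induction with
  | grade0 c => rw [AlgHom.commutes]; exact hc c
  | grade1 g => cases g; exacts [hE, hF, hK, hz]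
  | mul x y h1 h2 => rw [map_mul]; exact hmul _ _ h1 h2
  | add x y h1 h2 => rw [map_add]; exact hadd _ _ h1 h2

end DB

/-! ### Powers of a sum of `q`-commuting elements -/

/-- Gaussian binomial coefficients, through their Pascal rule. -/
def gaussBinom (q : ℂ) : ℕ → ℕ → ℂ
  | _, 0 => 1
  | 0, _ + 1 => 0
  | n + 1, k + 1 => gaussBinom q n k + q ^ (k + 1) * gaussBinom q n (k + 1)

theorem gaussBinom_zero_right (q : ℂ) (n : ℕ) : gaussBinom q n 0 = 1 := by
  cases n <;> rfl

theorem gaussBinom_succ (q : ℂ) (n k : ℕ) : gaussBinom q (n + 1) (k + 1)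
    = gaussBinom q n k + q ^ (k + 1) * gaussBinom q n (k + 1) := rfl

theorem gaussBinom_of_lt (q : ℂ) : ∀ n k : ℕ, n < k → gaussBinom q n k = 0
  | 0, 0, h => by omega
  | 0, k + 1, _ => rfl
  | n + 1, 0, h => by omega
  | n + 1, k + 1, h => by
    rw [gaussBinom_succ, gaussBinom_of_lt q n k (by omega),
      gaussBinom_of_lt q n (k + 1) (by omega)]; ring

theorem gaussBinom_self (q : ℂ) : ∀ n : ℕ, gaussBinom q n n = 1
  | 0 => rfl
  | n + 1 => by
    rw [gaussBinom_succ, gaussBinom_self q n, gaussBinom_of_lt q n (n + 1) (by omega)]; ring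

theorem gaussBinom_absorb (q : ℂ) (n : ℕ) : ∀ k : ℕ,
    (1 - q ^ (k + 1)) * gaussBinom q (n + 1) (k + 1) = (1 - q ^ (n + 1)) * gaussBinom q n k := by
  induction n with
  | zero =>
    intro k
    cases k with
    | zero => simp [gaussBinom]
    | succ k => simp [gaussBinom]
  | succ n ih =>
    intro k
    rw [gaussBinom_succ q (n + 1) k]
    cases k with
    | zero =>
      have h := ih 0
      simp only [gaussBinom_zero_right] at h ⊢
      linear_combination q * h
    | succ k =>
      have h1 := ih (k + 1)
      have h2 := ih k
      have h3 := gaussBinom_succ q n k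
      linear_combination q ^ (k + 2) * h1 + q * h2 - q * (1 - q ^ (n + 1)) * h3

theorem gaussBinom_root (h : IsPrimitiveRoot ζ d) {k : ℕ} (h0 : 0 < k) (h1 : k < d) :
    gaussBinom ζ d k = 0 := by
  obtain ⟨k, rfl⟩ : ∃ j, k = j + 1 := ⟨k - 1, by omega⟩
  obtain ⟨n, rfl⟩ : ∃ j, d = j + 1 := ⟨d - 1, by omega⟩
  have h2 := gaussBinom_absorb ζ n k
  rw [h.pow_eq_one, sub_self, zero_mul] at h2
  rcases mul_eq_zero.1 h2 with h3 | h3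
  · exact absurd (sub_eq_zero.1 h3).symm (h.pow_ne_one_of_pos_of_lt (by omega) h1)
  · exact h3

theorem q_comm_pow {A : Type*} [Ring A] [Algebra ℂ A] {x y : A} (q : ℂ)
    (h : y * x = q • (x * y)) (n : ℕ) : y * x ^ n = q ^ n • (x ^ n * y) := by
  induction n with
  | zero => simp
  | succ n ih =>
    rw [pow_succ, ← mul_assoc, ih, smul_mul_assoc, mul_assoc, h, mul_smul_comm, smul_smul,
      mul_assoc, pow_succ]

theorem q_add_pow {A : Type*} [Ring A] [Algebra ℂ A] {x y : A} (q : ℂ)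
    (h : y * x = q • (x * y)) (n : ℕ) :
    (x + y) ^ n = ∑ k ∈ Finset.range (n + 1), gaussBinom q n k • (x ^ k * y ^ (n - k)) := by
  induction n with
  | zero => simp [gaussBinom]
  | succ n ih =>
    rw [pow_succ', ih, add_mul, Finset.sum_range_succ' _ (n + 1), Finset.mul_sum,
      Finset.mul_sum]
    have e1 : ∑ k ∈ Finset.range (n + 1), y * gaussBinom q n k • (x ^ k * y ^ (n - k))
        = (∑ k ∈ Finset.range (n + 1), (q ^ (k + 1) * gaussBinom q n (k + 1)) •
            (x ^ (k + 1) * y ^ (n - k))) + y ^ (n + 1) := by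
      have e2 : ∀ k ∈ Finset.range (n + 1), y * gaussBinom q n k • (x ^ k * y ^ (n - k))
          = (q ^ k * gaussBinom q n k) • (x ^ k * y ^ (n + 1 - k)) := by
        intro k hk
        rw [Finset.mem_range] at hk
        rw [mul_smul_comm, ← mul_assoc, q_comm_pow q h, smul_mul_assoc, smul_smul, mul_assoc,
          ← pow_succ', mul_comm (gaussBinom q n k), show n - k + 1 = n + 1 - k by omega]
      rw [Finset.sum_congr rfl e2, Finset.sum_range_succ', Finset.sum_range_succ _ n,
        gaussBinom_of_lt q n (n + 1) (by omega)]
      simp [gaussBinom_zero_right]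
    rw [e1, ← add_assoc, ← Finset.sum_add_distrib]
    congr 1
    · refine Finset.sum_congr rfl fun k _ => ?_
      rw [gaussBinom_succ, add_smul, mul_smul_comm, ← mul_assoc, ← pow_succ',
        show n + 1 - (k + 1) = n - k by omega]
    · simp [gaussBinom_zero_right]

theorem q_add_pow_root (hd : 2 ≤ d) (hζ : IsPrimitiveRoot ζ d) {A : Type*} [Ring A]
    [Algebra ℂ A] {x y : A} (h : y * x = ζ • (x * y)) : (x + y) ^ d = x ^ d + y ^ d := by
  rw [q_add_pow ζ h, Finset.sum_range_succ, gaussBinom_self]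
  obtain ⟨n, rfl⟩ : ∃ j, d = j + 1 := ⟨d - 1, by omega⟩
  rw [Finset.sum_range_succ', Finset.sum_eq_zero]
  · simp [gaussBinom_zero_right, add_comm]
  · intro k hk
    rw [Finset.mem_range] at hk
    rw [gaussBinom_root hζ (by omega) (by omega), zero_smul]

namespace DB

theorem comul_relations : Relations d ζ
    ((1 : DB hd hζ) ⊗ₜ[ℂ] E hd hζ + E hd hζ ⊗ₜ[ℂ] K hd hζ)
    (F hd hζ ⊗ₜ[ℂ] (1 : DB hd hζ) + (z hd hζ * Kinv hd hζ) ⊗ₜ[ℂ] F hd hζ)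
    (K hd hζ ⊗ₜ[ℂ] K hd hζ) (z hd hζ ⊗ₜ[ℂ] z hd hζ) where
  K_pow := by simp [Algebra.TensorProduct.tmul_pow, K_pow, Algebra.TensorProduct.one_def]
  z_pow := by simp [Algebra.TensorProduct.tmul_pow, z_pow, Algebra.TensorProduct.one_def]
  E_pow := by
      rw [q_add_pow_root hd hζ]
      · simp [Algebra.TensorProduct.tmul_pow, E_pow]
      · simp [KE]
  F_pow := by
      rw [q_add_pow_root hd hζ]
      · simp [Algebra.TensorProduct.tmul_pow, F_pow]
      · rw [Algebra.TensorProduct.tmul_mul_tmul, Algebra.TensorProduct.tmul_mul_tmul, mul_assoc,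
          Kinv_F, mul_smul_comm, ← mul_assoc, zF, TensorProduct.smul_tmul', mul_one, one_mul,
          mul_assoc]
  zE := by simp [mul_add, add_mul, zE, zK]
  zF := by
      have h : z hd hζ * (z hd hζ * Kinv hd hζ) = z hd hζ * Kinv hd hζ * z hd hζ := by
        rw [mul_assoc, ← zKinv]
      simp [mul_add, add_mul, zF, h]
  zK := by simp [zK]
  KE := by simp [mul_add, add_mul, KE, TensorProduct.smul_tmul']
  KF := by
      have h : K hd hζ * (z hd hζ * Kinv hd hζ) = z hd hζ * Kinv hd hζ * K hd hζ := by
        rw [← mul_assoc, ← zK, mul_assoc, mul_assoc, K_mul_Kinv, Kinv_mul_K]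
      simp [mul_add, add_mul, KF, TensorProduct.smul_tmul', h]
  EF := by
      have h1 : (z hd hζ * Kinv hd hζ) * E hd hζ
          = ζ⁻¹ • (E hd hζ * (z hd hζ * Kinv hd hζ)) := by
        rw [mul_assoc, Kinv_E, mul_smul_comm, ← mul_assoc, zE, mul_assoc]
      have h2 := EF hd hζ
      have h3 : z hd hζ * Kinv hd hζ * K hd hζ = z hd hζ := by
        rw [mul_assoc, Kinv_mul_K, mul_one]
      have h4 : (K hd hζ ⊗ₜ[ℂ] K hd hζ) ^ (d - 1) = Kinv hd hζ ⊗ₜ Kinv hd hζ := by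
        rw [Algebra.TensorProduct.tmul_pow]; rfl
      rw [h4]
      have h5 : E hd hζ * F hd hζ = F hd hζ * E hd hζ + K hd hζ - z hd hζ * Kinv hd hζ := by
        rw [add_sub_assoc, ← h2]; abel
      simp only [mul_add, add_mul, Algebra.TensorProduct.tmul_mul_tmul, mul_one, one_mul, h1, h5,
        KF, TensorProduct.tmul_add, TensorProduct.add_tmul, TensorProduct.tmul_sub,
        TensorProduct.sub_tmul, TensorProduct.tmul_smul, TensorProduct.smul_tmul']
      abel

/-- The comultiplication:
`K ↦ K ⊗ K`, `z ↦ z ⊗ z`, `E ↦ 1 ⊗ E + E ⊗ K`, `F ↦ F ⊗ 1 + z K⁻¹ ⊗ F`. -/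
noncomputable def comulHom : DB hd hζ →ₐ[ℂ] DB hd hζ ⊗[ℂ] DB hd hζ :=
  lift hd hζ (comul_relations hd hζ)

theorem counit_relations (hd : 2 ≤ d) : Relations d ζ (0 : ℂ) 0 1 1 where
  K_pow := by simp
  z_pow := by simp
  E_pow := by simp; omega
  F_pow := by simp; omega
  zE := by simp
  zF := by simp
  zK := by simp
  KE := by simp
  KF := by simp
  EF := by simp

/-- The counit: `K, z ↦ 1` and `E, F ↦ 0`. -/
noncomputable def counitHom : DB hd hζ →ₐ[ℂ] ℂ := lift hd hζ (counit_relations hd)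

theorem comulHom_E : comulHom hd hζ (E hd hζ) = 1 ⊗ₜ E hd hζ + E hd hζ ⊗ₜ K hd hζ :=
  lift_E hd hζ _
theorem comulHom_F : comulHom hd hζ (F hd hζ)
    = F hd hζ ⊗ₜ 1 + (z hd hζ * Kinv hd hζ) ⊗ₜ F hd hζ :=
  lift_F hd hζ _
theorem comulHom_K : comulHom hd hζ (K hd hζ) = K hd hζ ⊗ₜ K hd hζ :=
  lift_K hd hζ _
theorem comulHom_z : comulHom hd hζ (z hd hζ) = z hd hζ ⊗ₜ z hd hζ :=
  lift_z hd hζ _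
theorem comulHom_Kinv : comulHom hd hζ (Kinv hd hζ) = Kinv hd hζ ⊗ₜ Kinv hd hζ := by
  rw [Kinv, map_pow, comulHom_K, Algebra.TensorProduct.tmul_pow]
theorem counitHom_E : counitHom hd hζ (E hd hζ) = 0 :=
  lift_E hd hζ _
theorem counitHom_F : counitHom hd hζ (F hd hζ) = 0 :=
  lift_F hd hζ _
theorem counitHom_K : counitHom hd hζ (K hd hζ) = 1 :=
  lift_K hd hζ _
theorem counitHom_z : counitHom hd hζ (z hd hζ) = 1 :=
  lift_z hd hζ _
theorem counitHom_Kinv : counitHom hd hζ (Kinv hd hζ) = 1 := by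
  rw [Kinv, map_pow, counitHom_K, one_pow]

/-- The bialgebra structure of `D(B)`. -/
noncomputable instance : Bialgebra ℂ (DB hd hζ) :=
  Bialgebra.ofAlgHom (comulHom hd hζ) (counitHom hd hζ)
    (by
      apply algHom_ext <;>
      simp [comulHom_E, comulHom_F, comulHom_K, comulHom_z, comulHom_Kinv,
        TensorProduct.tmul_add, TensorProduct.add_tmul, Algebra.TensorProduct.one_def, add_assoc])
    (by
      apply algHom_ext <;>
      simp [comulHom_E, comulHom_F, comulHom_K, comulHom_z, counitHom_E, counitHom_F, counitHom_K,
        counitHom_z, counitHom_Kinv])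
    (by
      apply algHom_ext <;>
      simp [comulHom_E, comulHom_F, comulHom_K, comulHom_z, counitHom_E, counitHom_F, counitHom_K,
        counitHom_z])

theorem z_comm (a : DB hd hζ) : z hd hζ * a = a * z hd hζ := by
  refine induct hd hζ (P := fun a => z hd hζ * a = a * z hd hζ) (fun c => ?_) (zE hd hζ)
    (zF hd hζ) (zK hd hζ) rfl (fun a b ha hb => ?_) (fun a b ha hb => ?_) a
  · exact (Algebra.commutes c _).symm
  · rw [← mul_assoc, ha, mul_assoc, hb, mul_assoc]
  · rw [mul_add, add_mul, ha, hb]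

theorem zinv_comm (a : DB hd hζ) : zinv hd hζ * a = a * zinv hd hζ :=
  (Commute.pow_left (z_comm hd hζ a) (d - 1)).eq

/-- A product of `q`-commuting elements whose first factor is nilpotent. -/
theorem mul_pow_q_zero {A : Type*} [Ring A] [Algebra ℂ A] {x y : A} {q : ℂ}
    (h : y * x = q • (x * y)) (n : ℕ) : ∃ c : ℂ, (x * y) ^ n = c • (x ^ n * y ^ n) := by
  induction n with
  | zero => exact ⟨1, by simp⟩
  | succ n ih =>
    obtain ⟨c, hc⟩ := ih
    refine ⟨c * q ^ n, ?_⟩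
    rw [pow_succ', hc, mul_smul_comm, mul_assoc, ← mul_assoc y, q_comm_pow q h, smul_mul_assoc,
      mul_smul_comm, smul_smul, pow_succ' x, pow_succ' y]
    simp only [mul_assoc]

open MulOpposite in
theorem antipode_relations : Relations d ζ
    (op (-(E hd hζ * Kinv hd hζ)))
    (op (-(ζ⁻¹ • (F hd hζ * K hd hζ * zinv hd hζ))))
    (op (Kinv hd hζ)) (op (zinv hd hζ)) where
  K_pow := by rw [← op_pow, Kinv, ← pow_mul, mul_comm, pow_mul, K_pow, one_pow, op_one]
  z_pow := by rw [← op_pow, zinv, ← pow_mul, mul_comm, pow_mul, z_pow, one_pow, op_one]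
  E_pow := by
      obtain ⟨c, hc⟩ := mul_pow_q_zero (Kinv_E hd hζ) d
      rw [← op_pow, neg_pow, hc, E_pow]; simp
  F_pow := by
      obtain ⟨c, hc⟩ := mul_pow_q_zero (KF hd hζ) d
      rw [← op_pow, neg_pow, smul_pow, (Commute.mul_pow (zinv_comm hd hζ _).symm), hc, F_pow]
      simp
  zE := by rw [← op_mul, ← op_mul, zinv_comm]
  zF := by rw [← op_mul, ← op_mul, zinv_comm]
  zK := by rw [← op_mul, ← op_mul, zinv_comm]
  KE := by
      rw [← op_mul, ← op_mul, ← op_smul, neg_mul, mul_neg, ← mul_assoc, Kinv_E, smul_neg,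
        smul_mul_assoc, smul_smul, mul_inv_cancel₀ (hζ.ne_zero (by omega)), one_smul]
  KF := by
      have h0 : ζ ≠ 0 := hζ.ne_zero (by omega)
      have h : F hd hζ * K hd hζ * zinv hd hζ * Kinv hd hζ = F hd hζ * zinv hd hζ := by
        rw [mul_assoc, zinv_comm, mul_assoc, ← mul_assoc (K hd hζ), K_mul_Kinv, one_mul]
      have h' : Kinv hd hζ * (F hd hζ * K hd hζ * zinv hd hζ) = ζ • (F hd hζ * zinv hd hζ) := by
        rw [← mul_assoc, ← mul_assoc, Kinv_F, smul_mul_assoc, mul_assoc _ _ (K hd hζ), Kinv_mul_K,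
          mul_one, smul_mul_assoc]
      rw [← op_mul, ← op_mul, ← op_smul, neg_mul, mul_neg, smul_neg, smul_mul_assoc,
        mul_smul_comm, h, h', smul_smul ζ⁻¹ ζ, inv_mul_cancel₀ h0, one_smul]
  EF := by
      have h0 : ζ ≠ 0 := hζ.ne_zero (by omega)
      have hK : Kinv hd hζ ^ (d - 1) = K hd hζ := by
        calc Kinv hd hζ ^ (d - 1) = Kinv hd hζ ^ (d - 1) * (Kinv hd hζ * K hd hζ) := by
              rw [Kinv_mul_K, mul_one]
          _ = K hd hζ := by
              rw [← mul_assoc, pow_sub_one_mul (by omega), Kinv, ← pow_mul, mul_comm, pow_mul,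
                K_pow, one_pow, one_mul]
      have h1 : F hd hζ * K hd hζ * zinv hd hζ * (E hd hζ * Kinv hd hζ)
          = ζ • (F hd hζ * E hd hζ * zinv hd hζ) := by
        calc F hd hζ * K hd hζ * zinv hd hζ * (E hd hζ * Kinv hd hζ)
            = F hd hζ * (K hd hζ * E hd hζ) * Kinv hd hζ * zinv hd hζ := by
              rw [mul_assoc _ (zinv hd hζ), zinv_comm]; simp only [mul_assoc]
          _ = ζ • (F hd hζ * E hd hζ * (K hd hζ * Kinv hd hζ) * zinv hd hζ) := by
              rw [KE]; simp only [mul_smul_comm, smul_mul_assoc, mul_assoc]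
          _ = _ := by rw [K_mul_Kinv, mul_one]
      have h2 : E hd hζ * Kinv hd hζ * (F hd hζ * K hd hζ * zinv hd hζ)
          = ζ • (E hd hζ * F hd hζ * zinv hd hζ) := by
        calc E hd hζ * Kinv hd hζ * (F hd hζ * K hd hζ * zinv hd hζ)
            = E hd hζ * (Kinv hd hζ * F hd hζ) * K hd hζ * zinv hd hζ := by
              simp only [mul_assoc]
          _ = ζ • (E hd hζ * F hd hζ * (Kinv hd hζ * K hd hζ) * zinv hd hζ) := by
              rw [Kinv_F]; simp only [mul_smul_comm, smul_mul_assoc, mul_assoc]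
          _ = _ := by rw [Kinv_mul_K, mul_one]
      have h3 : F hd hζ * E hd hζ - E hd hζ * F hd hζ
          = z hd hζ * Kinv hd hζ - K hd hζ := by
        rw [← neg_sub, EF, neg_sub]
      rw [← op_pow, hK, ← op_mul, ← op_mul, ← op_mul, ← op_sub, ← op_sub]
      congr 1
      rw [neg_mul_neg, neg_mul_neg, smul_mul_assoc, mul_smul_comm, h1, h2, smul_smul, smul_smul,
        inv_mul_cancel₀ h0, one_smul, one_smul, ← sub_mul, h3, sub_mul, ← zinv_comm, ← mul_assoc,
        zinv_mul_z, one_mul]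

/-- The antipode, as an algebra morphism to the opposite algebra:
`K ↦ K⁻¹`, `z ↦ z⁻¹`, `E ↦ - E K⁻¹`, `F ↦ - ζ⁻¹ F K z⁻¹`. -/
noncomputable def antipodeHom : DB hd hζ →ₐ[ℂ] (DB hd hζ)ᵐᵒᵖ :=
  lift hd hζ (antipode_relations hd hζ)

/-- The antipode as a linear endomorphism. -/
noncomputable def antipodeLin : DB hd hζ →ₗ[ℂ] DB hd hζ :=
  (MulOpposite.opLinearEquiv ℂ).symm.toLinearMap ∘ₗ (antipodeHom hd hζ).toLinearMap

theorem antipodeLin_mul (a b : DB hd hζ) :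
    antipodeLin hd hζ (a * b) = antipodeLin hd hζ b * antipodeLin hd hζ a := by
  simp [antipodeLin]
theorem antipodeLin_algebraMap (c : ℂ) :
    antipodeLin hd hζ (algebraMap ℂ _ c) = algebraMap ℂ _ c := by
  simp [antipodeLin]
theorem antipodeLin_one : antipodeLin hd hζ 1 = 1 := by simp [antipodeLin]
theorem antipodeLin_E : antipodeLin hd hζ (E hd hζ) = -(E hd hζ * Kinv hd hζ) := by
  simp [antipodeLin, antipodeHom, lift_E]
theorem antipodeLin_F : antipodeLin hd hζ (F hd hζ)
    = -(ζ⁻¹ • (F hd hζ * K hd hζ * zinv hd hζ)) := by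
  simp [antipodeLin, antipodeHom, lift_F]
theorem antipodeLin_K : antipodeLin hd hζ (K hd hζ) = Kinv hd hζ := by
  simp [antipodeLin, antipodeHom, lift_K]
theorem antipodeLin_z : antipodeLin hd hζ (z hd hζ) = zinv hd hζ := by
  simp [antipodeLin, antipodeHom, lift_z]
theorem antipodeLin_Kinv : antipodeLin hd hζ (Kinv hd hζ) = K hd hζ := by
  have h : antipodeLin hd hζ (Kinv hd hζ * K hd hζ) = 1 := by
    rw [Kinv_mul_K, antipodeLin_one]
  rw [antipodeLin_mul, antipodeLin_K] at h
  calc antipodeLin hd hζ (Kinv hd hζ)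
      = K hd hζ * (Kinv hd hζ * antipodeLin hd hζ (Kinv hd hζ)) := by
        rw [← mul_assoc, K_mul_Kinv, one_mul]
    _ = K hd hζ := by rw [h, mul_one]

theorem antipode_left (a : DB hd hζ) :
    LinearMap.mul' ℂ _ ((antipodeLin hd hζ).rTensor _ (comulHom hd hζ a))
      = algebraMap ℂ _ (counitHom hd hζ a) := by
  have key : ∀ u v : DB hd hζ ⊗[ℂ] DB hd hζ, ∀ c : ℂ,
      LinearMap.mul' ℂ _ ((antipodeLin hd hζ).rTensor _ u) = algebraMap ℂ _ c →
      LinearMap.mul' ℂ _ ((antipodeLin hd hζ).rTensor _ (u * v))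
        = algebraMap ℂ _ c * LinearMap.mul' ℂ _ ((antipodeLin hd hζ).rTensor _ v) := by
    intro u v c hu
    induction v using TensorProduct.induction_on with
    | zero => simp
    | add v w hv hw => rw [mul_add, map_add, map_add, hv, hw, map_add, map_add, mul_add]
    | tmul x y =>
      have h : LinearMap.mul' ℂ _ ((antipodeLin hd hζ).rTensor _ (u * (x ⊗ₜ y)))
          = antipodeLin hd hζ x
            * LinearMap.mul' ℂ _ ((antipodeLin hd hζ).rTensor _ u) * y := by
        clear hu
        induction u using TensorProduct.induction_on with
        | zero => simp
        | add v w hv hw =>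
          rw [add_mul, map_add, map_add, hv, hw, map_add, map_add, mul_add, add_mul]
        | tmul s t => simp [antipodeLin_mul, mul_assoc]
      rw [h, hu, ← Algebra.commutes]
      simp [mul_assoc]
  refine induct hd hζ (P := fun a =>
    LinearMap.mul' ℂ _ ((antipodeLin hd hζ).rTensor _ (comulHom hd hζ a))
      = algebraMap ℂ _ (counitHom hd hζ a)) (fun c => ?_) ?_ ?_ ?_ ?_ (fun a b ha hb => ?_)
      (fun a b ha hb => ?_) a
  · simp [Algebra.TensorProduct.algebraMap_apply, antipodeLin_algebraMap]
  · simp [comulHom_E, counitHom_E, antipodeLin_E, antipodeLin_one, mul_assoc, Kinv_mul_K]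
  · have h0 : ζ ≠ 0 := hζ.ne_zero (by omega)
    simp [comulHom_F, counitHom_F, antipodeLin_F, antipodeLin_mul, antipodeLin_Kinv,
      antipodeLin_z]
    rw [mul_assoc (K hd hζ), zinv_comm hd hζ (F hd hζ), ← mul_assoc (K hd hζ), KF, smul_mul_assoc,
      mul_assoc, neg_add_cancel]
  · simp [comulHom_K, counitHom_K, antipodeLin_K, Kinv_mul_K]
  · simp [comulHom_z, counitHom_z, antipodeLin_z, zinv_mul_z]
  · rw [map_mul, key _ _ _ ha, hb, map_mul, map_mul]
  · rw [map_add, map_add, map_add, ha, hb, map_add, map_add]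

theorem antipode_right (a : DB hd hζ) :
    LinearMap.mul' ℂ _ ((antipodeLin hd hζ).lTensor _ (comulHom hd hζ a))
      = algebraMap ℂ _ (counitHom hd hζ a) := by
  have key : ∀ u v : DB hd hζ ⊗[ℂ] DB hd hζ, ∀ c : ℂ,
      LinearMap.mul' ℂ _ ((antipodeLin hd hζ).lTensor _ u) = algebraMap ℂ _ c →
      LinearMap.mul' ℂ _ ((antipodeLin hd hζ).lTensor _ (v * u))
        = algebraMap ℂ _ c * LinearMap.mul' ℂ _ ((antipodeLin hd hζ).lTensor _ v) := by
    intro u v c hu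
    induction v using TensorProduct.induction_on with
    | zero => simp
    | add v w hv hw => rw [add_mul, map_add, map_add, hv, hw, map_add, map_add, mul_add]
    | tmul x y =>
      have h : LinearMap.mul' ℂ _ ((antipodeLin hd hζ).lTensor _ ((x ⊗ₜ y) * u))
          = x * LinearMap.mul' ℂ _ ((antipodeLin hd hζ).lTensor _ u) * antipodeLin hd hζ y := by
        clear hu
        induction u using TensorProduct.induction_on with
        | zero => simp
        | add v w hv hw =>
          rw [mul_add, map_add, map_add, hv, hw, map_add, map_add, mul_add, add_mul]
        | tmul s t => simp [antipodeLin_mul, mul_assoc]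
      rw [h, hu, ← Algebra.commutes]
      simp [mul_assoc]
  refine induct hd hζ (P := fun a =>
    LinearMap.mul' ℂ _ ((antipodeLin hd hζ).lTensor _ (comulHom hd hζ a))
      = algebraMap ℂ _ (counitHom hd hζ a)) (fun c => ?_) ?_ ?_ ?_ ?_ (fun a b ha hb => ?_)
      (fun a b ha hb => ?_) a
  · simp [Algebra.TensorProduct.algebraMap_apply, antipodeLin_one]
  · simp [comulHom_E, counitHom_E, antipodeLin_E, antipodeLin_K]
  · have h0 : ζ ≠ 0 := hζ.ne_zero (by omega)
    have h : z hd hζ * Kinv hd hζ * (F hd hζ * K hd hζ * zinv hd hζ) = ζ • F hd hζ := by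
      calc z hd hζ * Kinv hd hζ * (F hd hζ * K hd hζ * zinv hd hζ)
          = z hd hζ * (Kinv hd hζ * F hd hζ) * K hd hζ * zinv hd hζ := by simp only [mul_assoc]
        _ = ζ • (z hd hζ * (F hd hζ * (Kinv hd hζ * K hd hζ) * zinv hd hζ)) := by
          rw [Kinv_F]; simp only [mul_smul_comm, smul_mul_assoc, mul_assoc]
        _ = ζ • F hd hζ := by
          rw [Kinv_mul_K, mul_one, ← zinv_comm, ← mul_assoc, z_mul_zinv, one_mul]
    simp only [comulHom_F, counitHom_F, antipodeLin_F, antipodeLin_one, map_add,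
      LinearMap.lTensor_tmul, LinearMap.mul'_apply, mul_neg, mul_smul_comm, h, smul_smul,
      inv_mul_cancel₀ h0, one_smul, mul_one, add_neg_cancel, map_zero]
  · simp [comulHom_K, counitHom_K, antipodeLin_K, K_mul_Kinv]
  · simp [comulHom_z, counitHom_z, antipodeLin_z, z_mul_zinv]
  · rw [map_mul, key _ _ _ hb, ha, map_mul, map_mul, Algebra.commutes]
  · rw [map_add, map_add, map_add, ha, hb, map_add, map_add]

/-- The Hopf algebra structure of `D(B)`. -/
noncomputable instance : HopfAlgebra ℂ (DB hd hζ) where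
  antipode := antipodeLin hd hζ
  mul_antipode_rTensor_comul := LinearMap.ext (antipode_left hd hζ)
  mul_antipode_lTensor_comul := LinearMap.ext (antipode_right hd hζ)

end DB

/-! ## The `R`-matrix, the pivot, the characters and the simple modules of `D(B)` -/

/-- The `ζ`-number `(n)_ζ = 1 + ζ + ⋯ + ζ ^ (n - 1)`. -/
noncomputable def qNum (ζ : ℂ) (n : ℕ) : ℂ := ∑ k ∈ Finset.range n, ζ ^ k

/-- The `ζ`-factorial `(n)!_ζ = (1)_ζ (2)_ζ ⋯ (n)_ζ`. -/
noncomputable def qFact (ζ : ℂ) (n : ℕ) : ℂ := ∏ i ∈ Finset.range n, qNum ζ (i + 1)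

namespace DB

/-- The element `K* = K z⁻¹` of the dual of the Taft algebra. -/
noncomputable def Kstar : DB hd hζ := K hd hζ * zinv hd hζ

/-- The element `E* = ζ⁻¹ F K*` of the dual of the Taft algebra. -/
noncomputable def Estar : DB hd hζ := ζ⁻¹ • (F hd hζ * Kstar hd hζ)

/-- The basis of the dual of the Taft algebra that is dual to the basis `E ^ i K ^ j`. -/
noncomputable def dualBasis (i j : ℕ) : DB hd hζ :=
  ((d : ℂ) * qFact ζ i)⁻¹ •
    (Estar hd hζ ^ i * ∑ k ∈ Finset.range d, (ζ⁻¹ ^ (k * (i + j))) • Kstar hd hζ ^ k)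

/-- The universal `R`-matrix of the Drinfeld double: `R = ∑ E ^ i K ^ j ⊗ β_{i,j}`, where
`β_{i,j}` is the basis dual to `E ^ i K ^ j`. -/
noncomputable def Rmat : DB hd hζ ⊗[ℂ] DB hd hζ :=
  ∑ i ∈ Finset.range d, ∑ j ∈ Finset.range d,
    (E hd hζ ^ i * K hd hζ ^ j) ⊗ₜ[ℂ] dualBasis hd hζ i j

/-- The pivot `z⁻¹ K`. -/
noncomputable def pivot : (DB hd hζ)ˣ where
  val := zinv hd hζ * K hd hζ
  inv := Kinv hd hζ * z hd hζ
  val_inv := by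
    rw [mul_assoc, ← mul_assoc (K hd hζ), K_mul_Kinv, one_mul, zinv_mul_z]
  inv_val := by
    rw [mul_assoc, ← mul_assoc (z hd hζ), z_mul_zinv, one_mul, Kinv_mul_K]

theorem isGroupLike_K_z (i j : ℕ) : IsGroupLikeElem ℂ (K hd hζ ^ i * z hd hζ ^ j) where
  counit_eq_one := by
    change counitHom hd hζ _ = 1
    rw [map_mul, map_pow, map_pow, counitHom_K, counitHom_z, one_pow, one_pow, one_mul]
  comul_eq_tmul_self := by
    change comulHom hd hζ _ = _
    rw [map_mul, map_pow, map_pow, comulHom_K, comulHom_z, Algebra.TensorProduct.tmul_pow,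
      Algebra.TensorProduct.tmul_pow, Algebra.TensorProduct.tmul_mul_tmul]

/-- The character `χ_{i,j}`, `[M] ↦ Tr(K ^ i z ^ j |_M)`, of the Grothendieck ring. -/
noncomputable def χ (μ : ZMod d × ZMod d) : Groth (DB hd hζ) →+* ℂ :=
  Groth.traceChar (K hd hζ ^ μ.1.val * z hd hζ ^ μ.2.val) (isGroupLike_K_z hd hζ _ _)

end DB

section Simple

/-- The matrix of `K` on `M_{l,p}`: `ζ ^ p diag(ζ ^ (l - 1), …, ζ, 1)`. -/
noncomputable def matK (ζ : ℂ) (l p : ℕ) : Matrix (Fin l) (Fin l) ℂ :=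
  ζ ^ p • Matrix.diagonal fun i => ζ ^ (l - 1 - i.val)

/-- The matrix of `z` on `M_{l,p}`: the scalar `ζ ^ (2 p + l - 1)`. -/
noncomputable def matZ (ζ : ℂ) (l p : ℕ) : Matrix (Fin l) (Fin l) ℂ :=
  ζ ^ (2 * p + l - 1) • 1

/-- The matrix of `E` on `M_{l,p}`: the superdiagonal one with entries
`ζ ^ p (i)_ζ (ζ ^ (l - i) - 1)`, for `1 ≤ i ≤ l - 1` (the indices of `Fin l` start at `0`). -/
noncomputable def matE (ζ : ℂ) (l p : ℕ) : Matrix (Fin l) (Fin l) ℂ :=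
  ζ ^ p • Matrix.of fun i j =>
    if j.val = i.val + 1 then qNum ζ (i.val + 1) * (ζ ^ (l - (i.val + 1)) - 1) else 0

/-- The matrix of `F` on `M_{l,p}`: the subdiagonal one with entries `1`. -/
def matF (l : ℕ) : Matrix (Fin l) (Fin l) ℂ :=
  Matrix.of fun i j => if i.val = j.val + 1 then 1 else 0

theorem matE_pow (ζ : ℂ) (l p n : ℕ) (i j : Fin l) (h : j.val ≠ i.val + n) :
    (matE ζ l p ^ n) i j = 0 := by
  induction n generalizing j with
  | zero => rw [pow_zero, Matrix.one_apply_ne]; rintro rfl; exact h rfl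
  | succ n ih =>
    rw [pow_succ, Matrix.mul_apply]
    refine Finset.sum_eq_zero fun k _ => ?_
    by_cases hk : k.val = i.val + n
    · have : ¬ j.val = k.val + 1 := by omega
      simp [matE, this]
    · rw [ih k hk, zero_mul]

theorem matF_pow (l n : ℕ) (i j : Fin l) (h : i.val ≠ j.val + n) :
    (matF l ^ n) i j = 0 := by
  induction n generalizing j with
  | zero => rw [pow_zero, Matrix.one_apply_ne]; rintro rfl; exact h rfl
  | succ n ih =>
    rw [pow_succ, Matrix.mul_apply]
    refine Finset.sum_eq_zero fun k _ => ?_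
    by_cases hk : i.val = k.val + n
    · have : ¬ k.val = j.val + 1 := by omega
      simp [matF, this]
    · rw [ih k hk, zero_mul]

theorem matE_mul_matF (ζ : ℂ) (l p : ℕ) : matE ζ l p * matF l
    = ζ ^ p • Matrix.diagonal fun i : Fin l =>
        qNum ζ (i.val + 1) * (ζ ^ (l - (i.val + 1)) - 1) := by
  ext i j
  rw [matE, Matrix.smul_mul, Matrix.smul_apply, Matrix.smul_apply]
  congr 1
  rw [Matrix.mul_apply]
  by_cases hi : i.val + 1 < l
  · rw [Finset.sum_eq_single (⟨i.val + 1, hi⟩ : Fin l)]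
    · by_cases hij : i = j
      · subst hij; simp [matF]
      · have : ¬ i.val = j.val := fun h => hij (Fin.ext h)
        simp [matF, hij, this]
    · intro k _ hk
      have : ¬ k.val = i.val + 1 := fun h => hk (Fin.ext h)
      simp [this]
    · simp
  · have hl : l - (i.val + 1) = 0 := by omega
    rw [Finset.sum_eq_zero]
    · by_cases hij : i = j
      · subst hij; simp [hl]
      · simp [hij]
    · intro k _
      have : ¬ k.val = i.val + 1 := by omega
      simp [this]

theorem matF_mul_matE (ζ : ℂ) (l p : ℕ) : matF l * matE ζ l p
    = ζ ^ p • Matrix.diagonal fun i : Fin l => qNum ζ i.val * (ζ ^ (l - i.val) - 1) := by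
  ext i j
  rw [matE, Matrix.mul_smul, Matrix.smul_apply, Matrix.smul_apply]
  congr 1
  rw [Matrix.mul_apply]
  by_cases hi : 0 < i.val
  · have hk0 : i.val - 1 < l := by omega
    rw [Finset.sum_eq_single (⟨i.val - 1, hk0⟩ : Fin l)]
    · have h1 : i.val - 1 + 1 = i.val := by omega
      by_cases hij : i = j
      · subst hij; simp [matF, h1]
      · have : ¬ j.val = i.val := fun h => hij (Fin.ext h.symm)
        simp [matF, hij, this, h1]
    · intro k _ hk
      have : ¬ i.val = k.val + 1 := fun h => hk (Fin.ext (by simp [h]))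
      simp [matF, this]
    · simp
  · have hl : i.val = 0 := by omega
    rw [Finset.sum_eq_zero]
    · by_cases hij : i = j
      · subst hij; simp [hl, qNum]
      · simp [hij]
    · intro k _
      have : ¬ i.val = k.val + 1 := by omega
      simp [matF, this]

theorem simple_relations (hζ : IsPrimitiveRoot ζ d) (hd : 2 ≤ d) {l : ℕ} (hl1 : 1 ≤ l) (hl2 : l ≤ d) (p : ℕ) :
    Relations d ζ (matE ζ l p) (matF l) (matK ζ l p) (matZ ζ l p) where
  K_pow := by
    rw [matK, smul_pow, Matrix.diagonal_pow, ← pow_mul, mul_comm, pow_mul, hζ.pow_eq_one, one_pow,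
      one_smul, ← Matrix.diagonal_one]
    congr 1
    funext i
    simp only [Pi.pow_apply]
    rw [← pow_mul, mul_comm, pow_mul, hζ.pow_eq_one, one_pow]
  z_pow := by
    rw [matZ, smul_pow, one_pow, ← pow_mul, mul_comm, pow_mul, hζ.pow_eq_one, one_pow, one_smul]
  E_pow := by
    ext i j
    exact matE_pow ζ l p d i j (by omega)
  F_pow := by
    ext i j
    exact matF_pow l d i j (by omega)
  zE := by simp [matZ]
  zF := by simp [matZ]
  zK := by simp [matZ]
  KE := by
    ext i j
    rw [matK, Matrix.smul_mul, Matrix.mul_smul, Matrix.smul_apply, Matrix.smul_apply,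
      Matrix.smul_apply, Matrix.diagonal_mul, Matrix.mul_diagonal]
    by_cases h : j.val = i.val + 1
    · have e : l - 1 - i.val = (l - 1 - j.val) + 1 := by omega
      rw [e, pow_succ]
      simp only [smul_eq_mul]
      ring
    · simp [matE, h]
  KF := by
    have h0 : ζ ≠ 0 := hζ.ne_zero (by omega)
    ext i j
    rw [matK, Matrix.smul_mul, Matrix.mul_smul, Matrix.smul_apply, Matrix.smul_apply,
      Matrix.smul_apply, Matrix.diagonal_mul, Matrix.mul_diagonal]
    by_cases h : i.val = j.val + 1
    · have e : l - 1 - j.val = (l - 1 - i.val) + 1 := by omega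
      rw [e, pow_succ]
      simp only [smul_eq_mul]
      field_simp
    · simp [matF, h]
  EF := by
    have h0 : ζ ≠ 0 := hζ.ne_zero (by omega)
    have h1 : ζ - 1 ≠ 0 := sub_ne_zero.2 (hζ.ne_one (by omega))
    rw [matE_mul_matF, matF_mul_matE, matK, matZ, smul_pow, Matrix.diagonal_pow]
    ext i j
    by_cases hij : i = j
    · subst hij
      have hi := i.isLt
      obtain ⟨m, hm⟩ : ∃ m, l = i.val + 1 + m := ⟨l - (i.val + 1), by omega⟩
      have e1 : l - (i.val + 1) = m := by omega
      have e2 : l - i.val = m + 1 := by omega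
      have e3 : l - 1 - i.val = m := by omega
      have e4 : 2 * p + l - 1 = p + i.val + (p + m) := by omega
      have hinv : ∀ x : ℂ, x ^ d = 1 → x * x ^ (d - 1) = 1 := fun x hx => by
        rw [mul_pow_sub_one (by omega), hx]
      have e5 : ζ ^ (p + m) * (ζ ^ (p + m)) ^ (d - 1) = 1 := hinv _ (by
        rw [← pow_mul, mul_comm, pow_mul, hζ.pow_eq_one, one_pow])
      have q1 : qNum ζ (i.val + 1) = (ζ ^ (i.val + 1) - 1) / (ζ - 1) :=
        geom_sum_eq (sub_ne_zero.1 h1) _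
      have q2 : qNum ζ i.val = (ζ ^ i.val - 1) / (ζ - 1) := geom_sum_eq (sub_ne_zero.1 h1) _
      simp only [Matrix.sub_apply, Matrix.smul_apply, Matrix.diagonal_apply_eq, smul_eq_mul,
        Matrix.smul_mul, Matrix.mul_smul, Matrix.one_mul, e1, e2, e3, e4, q1, q2, Pi.pow_apply]
      have e6 : ζ ^ (p + i.val + (p + m)) * ((ζ ^ p) ^ (d - 1) * (ζ ^ m) ^ (d - 1))
          = ζ ^ (p + i.val) := by
        rw [← mul_pow, ← pow_add, pow_add ζ (p + i.val), mul_assoc, e5, mul_one]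
      rw [mul_left_comm ((ζ ^ p) ^ (d - 1)), e6]
      field_simp
      ring
    · simp [hij]

/-- The `D(B)`-module `M_{l,p}`, for `1 ≤ l ≤ d`, given by its matrices in its standard basis. -/
noncomputable def simpleMod {l : ℕ} (hl1 : 1 ≤ l) (hl2 : l ≤ d) (p : ZMod d) :
    FDMod (DB hd hζ) where
  V := Fin l → ℂ
  ρ := (Matrix.toLinAlgEquiv' (R := ℂ) (n := Fin l)).toAlgHom.comp
    (DB.lift hd hζ (simple_relations hζ hd hl1 hl2 p.val))

/-- The representative in `{1, …, d}` of a class modulo `d`. -/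
def toIcc (a : ZMod d) : ℕ := if a.val = 0 then d else a.val

theorem one_le_toIcc (hd : 2 ≤ d) (a : ZMod d) : 1 ≤ toIcc a := by
  unfold toIcc; split_ifs <;> omega

theorem toIcc_le (hd : 2 ≤ d) (a : ZMod d) : toIcc a ≤ d := by
  have : NeZero d := ⟨by omega⟩
  unfold toIcc
  split_ifs
  · exact le_rfl
  · exact (ZMod.val_lt a).le

/-- The module `M_μ = M_{l,p}` attached to `μ = (l, p)` in `ℤ/d × ℤ/d`, where `l` is represented in
`{1, …, d}`. -/
noncomputable def M (μ : ZMod d × ZMod d) : FDMod (DB hd hζ) :=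
  simpleMod hd hζ (one_le_toIcc hd μ.1) (toIcc_le hd μ.1) μ.2

end Simple
end Double
end DrinfeldTaft

/-! Write `T` for the trace functional of `M`. Both partial traces are actions on `M_λ` of one
element of `D(B)`, obtained from the monodromy `τ(R) R` by contracting one tensor factor against `T`
twisted by the pivot (`rightTr_act₂`, `leftTr_act₂`). The value is shown to be a scalar and then
computed on one vector.

Scalarity needs no irreducibility argument: on `M_λ` the eigenvalues of `K` are distinct because `l
≤ d`, and `F` links all the eigenlines, so an endomorphism commuting with `K` and `F` is a scalar
(`eq_smul_id_of_commute`). Hence only two intertwining relations of `R` are required, those for `K`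
and `F` (`Rmat_K`, `Rmat_mul_comul_F`). They make the monodromy commute with `Δ(K)` and `Δ(F)`, and
the pivot turns this into commutation of the contracted element with `K` and `F`
(`contractRight_pivot_F`, `contractLeft_pivot_F`).

For `s^+` the vector is `e_1`, killed by `E`; for `s^-` it is `e_l`, killed by `F`. If `K v = ζ^a v`
and `K* v = ζ^b v`, the nilpotent terms of the `R` acting first kill `v`, those of the other `R`
have non-trivial `K`-weight and so trace zero, and finite Fourier inversion collapses the Cartan
parts to `(K*)^a` and `K^b` (`contractRight_monodromy_apply`, `contractLeft_monodromy_apply`).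

For `s^-` this gives the trace of `K^(-l) z^(1-p)` at once. For `s^+` it gives the trace of `K^l
z^(-l-p)`, which has to be compared with that of `K^(-l) z^(-p)`. The missing ingredient is the
invariance of traces under `K ↔ z K⁻¹` (`trace_K_pow`). It holds for every functional with `T(ab) =
T(ba)`, by a recursion coming from the quantum Casimir element, and so avoids the classification of
simple modules. -/

namespace DrinfeldTaft

/-! ### The Casimir element and the symmetry of traces under `K ↔ z K⁻¹`. -/

section Symmetry
variable {d : ℕ} {ζ : ℂ} (hd : 2 ≤ d) (hζ : IsPrimitiveRoot ζ d)

theorem q_pow_comm {A : Type*} [Ring A] [Algebra ℂ A] {x y : A} {q : ℂ}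
    (h : y * x = q • (x * y)) (n : ℕ) : y ^ n * x = q ^ n • (x * y ^ n) := by
  induction n with
  | zero => simp
  | succ n ih =>
    rw [pow_succ, mul_assoc, h, mul_smul_comm, ← mul_assoc, ih, smul_mul_assoc, smul_smul,
      mul_assoc, pow_succ' q]

namespace DB

/-- The quantum Casimir element `(ζ - 1) E F + K + ζ z K⁻¹`. -/
noncomputable def casimir : DB hd hζ :=
  (ζ - 1) • (E hd hζ * F hd hζ) + K hd hζ + ζ • (z hd hζ * Kinv hd hζ)

/-- The relation for `EF - FE` trades the two orders of `E` and `F`. Having both forms makes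
centrality immediate: in `C E = E C` the form with `EF` on the left and the form with `FE` on the
right share the term `EFE`, and the remaining terms match by `KE = ζ EK`; the roles are exchanged
for `F`. -/
theorem casimir_eq : casimir hd hζ
    = (ζ - 1) • (F hd hζ * E hd hζ) + ζ • K hd hζ + z hd hζ * Kinv hd hζ := by
  have h := EF hd hζ
  rw [sub_eq_iff_eq_add] at h
  rw [casimir, h]
  module

theorem E_mul_Kinv : E hd hζ * Kinv hd hζ = ζ • (Kinv hd hζ * E hd hζ) := by
  rw [Kinv_E, smul_smul, mul_inv_cancel₀ (hζ.ne_zero (by omega)), one_smul]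

theorem F_mul_K : F hd hζ * K hd hζ = ζ • (K hd hζ * F hd hζ) := by
  rw [KF, smul_smul, mul_inv_cancel₀ (hζ.ne_zero (by omega)), one_smul]

theorem casimir_E : casimir hd hζ * E hd hζ = E hd hζ * casimir hd hζ := by
  conv_rhs => rw [casimir_eq]
  rw [casimir]
  simp only [add_mul, mul_add, smul_mul_assoc, mul_smul_comm, KE, mul_assoc]
  rw [← mul_assoc (E hd hζ) (z hd hζ), ← zE, mul_assoc, E_mul_Kinv, mul_smul_comm]

theorem casimir_F : casimir hd hζ * F hd hζ = F hd hζ * casimir hd hζ := by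
  conv_lhs => rw [casimir_eq]
  rw [casimir]
  simp only [add_mul, mul_add, smul_mul_assoc, mul_smul_comm, F_mul_K, mul_assoc]
  rw [← mul_assoc (F hd hζ) (z hd hζ), ← zF, mul_assoc, Kinv_F, mul_smul_comm]

theorem K_Kinv_comm : K hd hζ * Kinv hd hζ = Kinv hd hζ * K hd hζ := by
  rw [K_mul_Kinv, Kinv_mul_K]

theorem casimir_K : casimir hd hζ * K hd hζ = K hd hζ * casimir hd hζ := by
  have h : K hd hζ * (E hd hζ * F hd hζ) = E hd hζ * F hd hζ * K hd hζ := by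
    rw [← mul_assoc, KE, mul_assoc (E hd hζ) (F hd hζ), F_mul_K, smul_mul_assoc, mul_smul_comm,
      mul_assoc]
  rw [casimir]
  simp only [add_mul, mul_add, smul_mul_assoc, mul_smul_comm, h]
  rw [← mul_assoc (K hd hζ), ← zK]
  simp only [mul_assoc, K_Kinv_comm]

theorem casimir_comm (a : DB hd hζ) : casimir hd hζ * a = a * casimir hd hζ := by
  refine induct hd hζ (P := fun a => casimir hd hζ * a = a * casimir hd hζ) (fun c => ?_)
    (casimir_E hd hζ) (casimir_F hd hζ) (casimir_K hd hζ) (z_comm hd hζ _).symm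
    (fun a b ha hb => ?_) (fun a b ha hb => ?_) a
  · exact (Algebra.commutes c _).symm
  · rw [← mul_assoc, ha, mul_assoc, hb, mul_assoc]
  · rw [mul_add, add_mul, ha, hb]

variable (T : DB hd hζ →ₗ[ℂ] ℂ) (hT : ∀ a b, T (a * b) = T (b * a))
include hT

/-- Cyclicity moves `E` around the trace at the cost of the factor `q`, so the `EF` term of one form
of the Casimir element is `q` times the `FE` term of the other. Subtracting `q` times the second
form from the first eliminates `E` and `F`, and leaves a recursion between traces of Cartan
elements. -/
theorem trace_casimir_mul {X L : DB hd hζ} {q : ℂ} (hX : ∀ a, X * a = a * X)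
    (hL : L * E hd hζ = q • (E hd hζ * L)) :
    (1 - q) * T (X * (casimir hd hζ * L)) = (1 - ζ * q) * T (X * (K hd hζ * L))
      + (ζ - q) * T (X * (z hd hζ * Kinv hd hζ * L)) := by
  have h1 : T (X * (E hd hζ * F hd hζ * L)) = q * T (X * (F hd hζ * E hd hζ * L)) := by
    rw [mul_assoc (E hd hζ), ← mul_assoc X, hX, mul_assoc, hT]
    simp only [mul_assoc]
    rw [hL, mul_smul_comm, mul_smul_comm, map_smul, smul_eq_mul]
  have h2 : T (X * (casimir hd hζ * L)) = (ζ - 1) * T (X * (E hd hζ * F hd hζ * L))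
      + T (X * (K hd hζ * L)) + ζ * T (X * (z hd hζ * Kinv hd hζ * L)) := by
    rw [casimir]
    simp only [add_mul, mul_add, smul_mul_assoc, mul_smul_comm, map_add, map_smul, smul_eq_mul]
  have h3 : T (X * (casimir hd hζ * L)) = (ζ - 1) * T (X * (F hd hζ * E hd hζ * L))
      + ζ * T (X * (K hd hζ * L)) + T (X * (z hd hζ * Kinv hd hζ * L)) := by
    rw [casimir_eq]
    simp only [add_mul, mul_add, smul_mul_assoc, mul_smul_comm, map_add, map_smul, smul_eq_mul]
  linear_combination h2 - q * h3 + (ζ - 1) * h1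

/-- The symmetry `K ↔ z K⁻¹` of a trace functional. -/
theorem trace_K_pow (n : ℕ) : ∀ X : DB hd hζ, (∀ a, X * a = a * X) →
    T (X * K hd hζ ^ n) = T (X * (z hd hζ ^ n * Kinv hd hζ ^ n)) := by
  have h0 : ζ ≠ 0 := hζ.ne_zero (by omega)
  have h1 : ζ - 1 ≠ 0 := sub_ne_zero.2 (hζ.ne_one (by omega))
  have zp : ∀ (m : ℕ) a, z hd hζ ^ m * a = a * z hd hζ ^ m := fun m a =>
    (Commute.pow_left (z_comm hd hζ a) m).eq
  induction n using Nat.twoStepInduction with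
  | zero => simp
  | one =>
    intro X hX
    -- For `q = 1` the Casimir term has coefficient zero and the recursion itself is the claim,
    -- multiplied by `ζ - 1`.
    have h := trace_casimir_mul hd hζ T hT (L := 1) (q := 1) hX (by simp)
    simp only [mul_one, pow_one] at h ⊢
    refine mul_left_cancel₀ h1 ?_
    linear_combination h
  | more n ih1 ih2 =>
    intro X hX
    -- The recursion determines the next trace up to the factor `1 - ζ^(n+2)`. When this factor
    -- vanishes, `d` divides `n + 2` and both powers equal `1`.
    by_cases hn : ζ ^ (n + 2) = 1
    · obtain ⟨m, hm⟩ := (hζ.pow_eq_one_iff_dvd _).1 hn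
      rw [hm, Kinv, pow_mul, pow_mul, ← pow_mul _ (d - 1), mul_comm (d - 1), mul_assoc d,
        mul_comm m, ← mul_assoc, mul_assoc, pow_mul (K hd hζ) d, K_pow, z_pow]
      simp
    · have hXz : ∀ m a, X * z hd hζ ^ m * a = a * (X * z hd hζ ^ m) := fun m a => by
        rw [mul_assoc, zp, ← mul_assoc, hX, mul_assoc]
      have hXC : ∀ a, X * casimir hd hζ * a = a * (X * casimir hd hζ) := fun a => by
        rw [mul_assoc, casimir_comm, ← mul_assoc, hX, mul_assoc]
      -- The recursion is used for `K^(n+1)`, with `q = ζ^(n+1)`, and for `K^(-n-1)`, with `q⁻¹` and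
      -- with `X z^(n+1)` in place of `X`. Multiplied by `-q`, the second acquires the coefficients
      -- of the first.
      have e1 := trace_casimir_mul hd hζ T hT hX (q_pow_comm (KE hd hζ) (n + 1))
      have e2 := trace_casimir_mul hd hζ T hT (hXz (n + 1)) (q_pow_comm (Kinv_E hd hζ) (n + 1))
      -- The two induction hypotheses are needed for `X z` and for `X C`, with `C` the Casimir
      -- element; this is why `X` ranges over all central elements.
      have e3 := ih1 (X * z hd hζ ^ 1) (hXz 1)
      have e4 := ih2 _ hXC
      rw [← pow_succ' (K hd hζ)] at e1
      have r1 : z hd hζ * Kinv hd hζ * K hd hζ ^ (n + 1) = z hd hζ * K hd hζ ^ n := by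
        rw [pow_succ', mul_assoc, ← mul_assoc (Kinv hd hζ), Kinv_mul_K, one_mul]
      have r2 : K hd hζ * Kinv hd hζ ^ (n + 1) = Kinv hd hζ ^ n := by
        rw [pow_succ', ← mul_assoc, K_mul_Kinv, one_mul]
      have r3 : X * z hd hζ ^ (n + 1) * (z hd hζ * Kinv hd hζ * Kinv hd hζ ^ (n + 1))
          = X * (z hd hζ ^ (n + 2) * Kinv hd hζ ^ (n + 2)) := by
        rw [pow_succ (z hd hζ) (n + 1), pow_succ' (Kinv hd hζ) (n + 1)]
        simp only [mul_assoc]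
      have r4 : X * z hd hζ ^ 1 * (z hd hζ ^ n * Kinv hd hζ ^ n)
          = X * z hd hζ ^ (n + 1) * Kinv hd hζ ^ n := by
        rw [pow_succ' (z hd hζ) n, pow_one]
        simp only [mul_assoc]
      have r5 : X * casimir hd hζ * (z hd hζ ^ (n + 1) * Kinv hd hζ ^ (n + 1))
          = X * z hd hζ ^ (n + 1) * (casimir hd hζ * Kinv hd hζ ^ (n + 1)) := by
        rw [mul_assoc, ← mul_assoc (casimir hd hζ), ← zp]
        simp only [mul_assoc]
      rw [r1] at e1
      rw [r2, r3] at e2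
      rw [r4, pow_one, mul_assoc] at e3
      rw [r5, mul_assoc] at e4
      have hq : ζ ^ (n + 1) * ζ⁻¹ ^ (n + 1) = 1 := by
        rw [← mul_pow, mul_inv_cancel₀ h0, one_pow]
      have h2 : 1 - ζ ^ (n + 2) ≠ 0 := sub_ne_zero.2 (Ne.symm hn)
      refine mul_left_cancel₀ h2 ?_
      generalize ζ⁻¹ ^ (n + 1) = q' at *
      have hq2 : ζ ^ (n + 2) = ζ * ζ ^ (n + 1) := pow_succ' ζ (n + 1)
      rw [hq2]
      generalize ζ ^ (n + 1) = q at *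
      generalize T (X * (casimir hd hζ * K hd hζ ^ (n + 1))) = t1 at *
      generalize T (X * K hd hζ ^ (n + 1 + 1)) = t2 at *
      generalize T (X * (z hd hζ * K hd hζ ^ n)) = t3 at *
      generalize T (X * z hd hζ ^ (n + 1) * (casimir hd hζ * Kinv hd hζ ^ (n + 1))) = t4 at *
      generalize T (X * z hd hζ ^ (n + 1) * Kinv hd hζ ^ n) = t5 at *
      generalize T (X * (z hd hζ ^ (n + 2) * Kinv hd hζ ^ (n + 2))) = t6 at *
      linear_combination (-1) * e1 - q * e2 + (1 - q) * e4 - (ζ - q) * e3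
        - (t4 - ζ * t5 - t6) * hq

end DB
end Symmetry

/-! ### Commutation of the `R`-matrix and of the monodromy with `Δ(F)` and `Δ(K)`. -/

section Intertwining
variable {d : ℕ} {ζ : ℂ}

/-- Shift invariance of a sum over `ℤ/d`, in the form in which exponents of `K` and `K*` get
reindexed below. -/
theorem sum_range_succ_periodic {A : Type*} [AddCommGroup A] (f : ℕ → A) (h : f d = f 0) :
    ∑ j ∈ Finset.range d, f (j + 1) = ∑ j ∈ Finset.range d, f j := by
  have h1 := Finset.sum_range_succ f d
  rw [Finset.sum_range_succ', h] at h1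
  exact add_right_cancel h1

theorem qNum_succ (ζ : ℂ) (n : ℕ) : qNum ζ (n + 1) = qNum ζ n + ζ ^ n :=
  Finset.sum_range_succ _ _

theorem qNum_succ' (ζ : ℂ) (n : ℕ) : qNum ζ (n + 1) = 1 + ζ * qNum ζ n := by
  rw [qNum, Finset.sum_range_succ', qNum, Finset.mul_sum, pow_zero, add_comm]
  simp only [pow_succ']

theorem qNum_ne_zero (hζ : IsPrimitiveRoot ζ d) {n : ℕ} (h0 : 0 < n) (h1 : n < d) :
    qNum ζ n ≠ 0 := by
  intro h
  have h2 : qNum ζ n * (ζ - 1) = ζ ^ n - 1 := geom_sum_mul ζ n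
  rw [h, zero_mul] at h2
  exact hζ.pow_ne_one_of_pos_of_lt (by omega) h1 (sub_eq_zero.1 h2.symm)

variable (hd : 2 ≤ d) (hζ : IsPrimitiveRoot ζ d)

namespace DB

theorem Kstar_F : Kstar hd hζ * F hd hζ = ζ⁻¹ • (F hd hζ * Kstar hd hζ) := by
  rw [Kstar, mul_assoc, zinv_comm, ← mul_assoc, KF, smul_mul_assoc, mul_assoc]

theorem K_Kstar : K hd hζ * Kstar hd hζ = Kstar hd hζ * K hd hζ := by
  rw [Kstar, mul_assoc (K hd hζ), zinv_comm]

theorem Kstar_mul_zKinv : Kstar hd hζ * (z hd hζ * Kinv hd hζ) = 1 := by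
  rw [Kstar, mul_assoc, ← mul_assoc (zinv hd hζ), zinv_mul_z, one_mul, K_mul_Kinv]

theorem zKinv_mul_Kstar : z hd hζ * Kinv hd hζ * Kstar hd hζ = 1 := by
  rw [Kstar, mul_assoc, ← mul_assoc (Kinv hd hζ), Kinv_mul_K, one_mul, z_mul_zinv]

theorem Kstar_pow : Kstar hd hζ ^ d = 1 := by
  rw [Kstar, (Commute.mul_pow (zinv_comm hd hζ _).symm), K_pow, zinv, ← pow_mul, mul_comm (d - 1),
    pow_mul, z_pow, one_pow, one_mul]

theorem K_Estar : K hd hζ * Estar hd hζ = ζ⁻¹ • (Estar hd hζ * K hd hζ) := by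
  rw [Estar, mul_smul_comm, ← mul_assoc, KF, smul_mul_assoc, smul_mul_assoc, mul_assoc, mul_assoc,
    K_Kstar]

theorem Estar_mul_zKinv : Estar hd hζ * (z hd hζ * Kinv hd hζ) = ζ⁻¹ • F hd hζ := by
  rw [Estar, smul_mul_assoc, mul_assoc, Kstar_mul_zKinv, mul_one]

theorem zKinv_Estar : z hd hζ * Kinv hd hζ * Estar hd hζ
    = ζ • (Estar hd hζ * (z hd hζ * Kinv hd hζ)) := by
  have h : Kinv hd hζ * Kstar hd hζ = Kstar hd hζ * Kinv hd hζ := by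
    rw [Kstar, mul_assoc, zinv_comm, ← mul_assoc, ← mul_assoc, K_Kinv_comm]
  rw [Estar, mul_assoc, mul_smul_comm, ← mul_assoc (Kinv hd hζ), Kinv_F, smul_mul_assoc, mul_assoc,
    h, ← mul_assoc, mul_smul_comm, mul_smul_comm, ← mul_assoc (z hd hζ), z_comm, smul_mul_assoc,
    smul_comm, mul_assoc _ (z hd hζ)]

theorem F_mul_Estar : F hd hζ * Estar hd hζ = ζ • (Estar hd hζ * F hd hζ) := by
  rw [Estar, mul_smul_comm, smul_mul_assoc, mul_assoc, Kstar_F, mul_smul_comm, smul_smul ζ,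
    mul_inv_cancel₀ (hζ.ne_zero (by omega)), one_smul]

/-- Up to a scalar, `(E*)^(d-1)` is `F^(d-1) (K*)^(d-1)`, and carrying the last `F` to the left
creates `F^d`. -/
theorem Estar_pow_mul_F : Estar hd hζ ^ (d - 1) * F hd hζ = 0 := by
  obtain ⟨c, hc⟩ := mul_pow_q_zero (Kstar_F hd hζ) (d - 1)
  rw [Estar, smul_pow, hc, smul_mul_assoc, smul_mul_assoc, mul_assoc,
    q_pow_comm (Kstar_F hd hζ), mul_smul_comm, ← mul_assoc, pow_sub_one_mul (by omega), F_pow]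
  simp

theorem E_pow_F (n : ℕ) : E hd hζ ^ (n + 1) * F hd hζ - F hd hζ * E hd hζ ^ (n + 1)
    = qNum ζ (n + 1) • (E hd hζ ^ n * (K hd hζ - ζ⁻¹ ^ n • (z hd hζ * Kinv hd hζ))) := by
  induction n with
  | zero => simp [qNum, EF]
  | succ n ih =>
    have h0 : ζ ≠ 0 := hζ.ne_zero (by omega)
    have e1 : E hd hζ ^ (n + 1 + 1) * F hd hζ - F hd hζ * E hd hζ ^ (n + 1 + 1)
        = E hd hζ * (E hd hζ ^ (n + 1) * F hd hζ - F hd hζ * E hd hζ ^ (n + 1))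
          + (E hd hζ * F hd hζ - F hd hζ * E hd hζ) * E hd hζ ^ (n + 1) := by
      rw [pow_succ' _ (n + 1), mul_sub, sub_mul]
      simp only [mul_assoc]
      abel
    have e2 : z hd hζ * Kinv hd hζ * E hd hζ ^ (n + 1)
        = ζ⁻¹ ^ (n + 1) • (E hd hζ ^ (n + 1) * (z hd hζ * Kinv hd hζ)) := by
      rw [mul_assoc, q_comm_pow _ (Kinv_E hd hζ), mul_smul_comm, ← mul_assoc, z_comm, mul_assoc]
    rw [e1, ih, EF, sub_mul, q_comm_pow _ (KE hd hζ), e2, mul_smul_comm, ← mul_assoc, ← pow_succ',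
      mul_sub, mul_sub, mul_smul_comm, mul_smul_comm]
    have h1 := qNum_succ ζ (n + 1)
    have h2 : qNum ζ (n + 1 + 1) * ζ⁻¹ ^ (n + 1) = qNum ζ (n + 1) * ζ⁻¹ ^ n + ζ⁻¹ ^ (n + 1) := by
      rw [qNum_succ' ζ (n + 1), pow_succ]
      field_simp
      ring
    rw [smul_sub _ _ (ζ⁻¹ ^ (n + 1) • _), smul_smul (qNum ζ (n + 1 + 1)), h2, h1]
    module

/-- The Cartan part of the `R`-matrix, multiplied by `d` and twisted by `K ^ (-i)`. -/
noncomputable def cartan (i : ℕ) : DB hd hζ ⊗[ℂ] DB hd hζ :=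
  ∑ j ∈ Finset.range d, ∑ k ∈ Finset.range d,
    ζ⁻¹ ^ (k * (i + j)) • ((K hd hζ ^ j) ⊗ₜ[ℂ] (Kstar hd hζ ^ k))

theorem K_mul_cartan (i : ℕ) :
    (K hd hζ ⊗ₜ[ℂ] (1 : DB hd hζ)) * cartan hd hζ (i + 1) = cartan hd hζ i := by
  rw [cartan, cartan]
  refine Eq.trans ?_ (sum_range_succ_periodic _ ?_)
  rotate_left
  · refine Finset.sum_congr rfl fun k _ => ?_
    rw [K_pow, pow_zero, mul_add, pow_add, mul_comm k d, pow_mul _ d, inv_pow ζ d, hζ.pow_eq_one]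
    simp
  · simp only [Finset.mul_sum, mul_smul_comm, Algebra.TensorProduct.tmul_mul_tmul, one_mul,
      ← pow_succ', add_assoc, add_comm 1]

/-- Multiplying by `K` on the left factor shifts the summation index `j`, which lowers the twist `i`
by one. All twisted Cartan parts are thus one Cartan part times a power of `K⁻¹`, and `R` splits as
a nilpotent part times a Cartan part (`Rmat_eq`). -/
theorem cartan_eq (i : ℕ) :
    cartan hd hζ i = ((Kinv hd hζ ^ i) ⊗ₜ[ℂ] (1 : DB hd hζ)) * cartan hd hζ 0 := by
  induction i with
  | zero => simp [← Algebra.TensorProduct.one_def]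
  | succ n ih =>
    rw [pow_succ', ← one_mul (1 : DB hd hζ), ← Algebra.TensorProduct.tmul_mul_tmul, mul_assoc, ← ih,
      ← K_mul_cartan hd hζ n, ← mul_assoc, Algebra.TensorProduct.tmul_mul_tmul, Kinv_mul_K, one_mul,
      ← Algebra.TensorProduct.one_def, one_mul]

theorem cartan_mul_one_F : cartan hd hζ 0 * ((1 : DB hd hζ) ⊗ₜ[ℂ] F hd hζ)
    = (Kinv hd hζ ⊗ₜ[ℂ] F hd hζ) * cartan hd hζ 0 := by
  have h : cartan hd hζ 0 * ((1 : DB hd hζ) ⊗ₜ[ℂ] F hd hζ)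
      = ((1 : DB hd hζ) ⊗ₜ[ℂ] F hd hζ) * cartan hd hζ 1 := by
    simp only [cartan, Finset.sum_mul, Finset.mul_sum, smul_mul_assoc, mul_smul_comm,
      Algebra.TensorProduct.tmul_mul_tmul, one_mul, mul_one]
    refine Finset.sum_congr rfl fun j _ => Finset.sum_congr rfl fun k _ => ?_
    rw [q_pow_comm (Kstar_F hd hζ), TensorProduct.tmul_smul, smul_smul, ← pow_add]
    congr 2
    ring
  rw [h, cartan_eq, ← mul_assoc, Algebra.TensorProduct.tmul_mul_tmul, one_mul, mul_one, pow_one]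

theorem cartan_mul_F_one : cartan hd hζ 0 * (F hd hζ ⊗ₜ[ℂ] (1 : DB hd hζ))
    = (F hd hζ ⊗ₜ[ℂ] (z hd hζ * Kinv hd hζ)) * cartan hd hζ 0 := by
  -- Moving `F` past `K^j` produces `ζ^(-j)`, which is exactly the change of coefficient when `k`
  -- becomes `k + 1`. The extra factor `K*` performs this shift, and is removed at the end through
  -- its inverse `z K⁻¹`.
  have h : ((1 : DB hd hζ) ⊗ₜ[ℂ] Kstar hd hζ) * (cartan hd hζ 0 * (F hd hζ ⊗ₜ[ℂ] (1 : DB hd hζ)))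
      = (F hd hζ ⊗ₜ[ℂ] (1 : DB hd hζ)) * cartan hd hζ 0 := by
    simp only [cartan, Finset.sum_mul, Finset.mul_sum, smul_mul_assoc, mul_smul_comm,
      Algebra.TensorProduct.tmul_mul_tmul, one_mul, mul_one]
    refine Finset.sum_congr rfl fun j _ => ?_
    rw [← sum_range_succ_periodic (fun k => ζ⁻¹ ^ (k * (0 + j)) •
      ((F hd hζ * K hd hζ ^ j) ⊗ₜ[ℂ] (Kstar hd hζ ^ k)))]
    · refine Finset.sum_congr rfl fun k _ => ?_
      rw [q_pow_comm (KF hd hζ), ← TensorProduct.smul_tmul', smul_smul, ← pow_add, ← pow_succ']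
      congr 2
      ring
    · rw [pow_mul, inv_pow, hζ.pow_eq_one, Kstar_pow]
      simp
  have e : F hd hζ ⊗ₜ[ℂ] (z hd hζ * Kinv hd hζ)
      = ((1 : DB hd hζ) ⊗ₜ[ℂ] (z hd hζ * Kinv hd hζ)) * (F hd hζ ⊗ₜ[ℂ] (1 : DB hd hζ)) := by
    rw [Algebra.TensorProduct.tmul_mul_tmul, one_mul, mul_one]
  rw [e, mul_assoc, ← h, ← mul_assoc, Algebra.TensorProduct.tmul_mul_tmul, zKinv_mul_Kstar, one_mul,
    ← Algebra.TensorProduct.one_def, one_mul]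

theorem cartan_mul_zKinv : cartan hd hζ 0 * ((z hd hζ * Kinv hd hζ) ⊗ₜ[ℂ] (1 : DB hd hζ))
    = ((z hd hζ * Kinv hd hζ) ⊗ₜ[ℂ] (1 : DB hd hζ)) * cartan hd hζ 0 := by
  simp only [cartan, Finset.sum_mul, Finset.mul_sum, smul_mul_assoc, mul_smul_comm,
      Algebra.TensorProduct.tmul_mul_tmul, one_mul, mul_one]
  refine Finset.sum_congr rfl fun j _ => Finset.sum_congr rfl fun k _ => ?_
  rw [← mul_assoc, ← z_comm, mul_assoc, mul_assoc, Kinv, pow_mul_comm]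

/-- The nilpotent part of the `R`-matrix, divided by `d`. -/
noncomputable def quasiR : DB hd hζ ⊗[ℂ] DB hd hζ :=
  ∑ i ∈ Finset.range d, ((d : ℂ) * qFact ζ i)⁻¹ •
    ((E hd hζ ^ i * Kinv hd hζ ^ i) ⊗ₜ[ℂ] (Estar hd hζ ^ i))

theorem Rmat_eq : Rmat hd hζ = quasiR hd hζ * cartan hd hζ 0 := by
  rw [Rmat, quasiR, Finset.sum_mul]
  refine Finset.sum_congr rfl fun i _ => ?_
  rw [← mul_one (Estar hd hζ ^ i), ← Algebra.TensorProduct.tmul_mul_tmul, smul_mul_assoc, mul_assoc,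
    ← cartan_eq]
  simp only [cartan, dualBasis, Finset.mul_sum, Finset.smul_sum, TensorProduct.tmul_sum,
    TensorProduct.tmul_smul, mul_smul_comm, Algebra.TensorProduct.tmul_mul_tmul]

/-- The correction here, with second factor `(E*)^n F`, is the one that reappears in
`quasiR_term_succ` multiplied by `(n+1)_ζ`. The two families of corrections cancel in `quasiR_comm`.
-/
theorem quasiR_term (n : ℕ) :
    ((E hd hζ ^ n * Kinv hd hζ ^ n) ⊗ₜ[ℂ] (Estar hd hζ ^ n))
        * ((z hd hζ * Kinv hd hζ * Kinv hd hζ) ⊗ₜ[ℂ] F hd hζ)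
      + (E hd hζ ^ n * Kinv hd hζ ^ n * (ζ ^ n • 1 - z hd hζ * Kinv hd hζ * Kinv hd hζ))
          ⊗ₜ[ℂ] (Estar hd hζ ^ n * F hd hζ)
    = ((1 : DB hd hζ) ⊗ₜ[ℂ] F hd hζ)
        * ((E hd hζ ^ n * Kinv hd hζ ^ n) ⊗ₜ[ℂ] (Estar hd hζ ^ n)) := by
  rw [Algebra.TensorProduct.tmul_mul_tmul, Algebra.TensorProduct.tmul_mul_tmul,
    q_comm_pow _ (F_mul_Estar hd hζ), mul_sub, TensorProduct.sub_tmul, mul_smul_comm, mul_one,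
    one_mul, TensorProduct.tmul_smul, TensorProduct.smul_tmul']
  abel

/-- The correction is the commutator of `E^(n+1)` with `F`, computed in `E_pow_F`; the last factor
of `(E*)^(n+1)` absorbs `z K⁻¹` and becomes a multiple of `F`. -/
theorem quasiR_term_succ (n : ℕ) :
    ((E hd hζ ^ (n + 1) * Kinv hd hζ ^ (n + 1)) ⊗ₜ[ℂ] (Estar hd hζ ^ (n + 1)))
        * (F hd hζ ⊗ₜ[ℂ] (z hd hζ * Kinv hd hζ))
    = (F hd hζ ⊗ₜ[ℂ] (z hd hζ * Kinv hd hζ))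
        * ((E hd hζ ^ (n + 1) * Kinv hd hζ ^ (n + 1)) ⊗ₜ[ℂ] (Estar hd hζ ^ (n + 1)))
      + qNum ζ (n + 1) •
        ((E hd hζ ^ n * Kinv hd hζ ^ n * (ζ ^ n • 1 - z hd hζ * Kinv hd hζ * Kinv hd hζ))
          ⊗ₜ[ℂ] (Estar hd hζ ^ n * F hd hζ)) := by
  have h0 : ζ ≠ 0 := hζ.ne_zero (by omega)
  rw [Algebra.TensorProduct.tmul_mul_tmul, Algebra.TensorProduct.tmul_mul_tmul, mul_assoc,
    q_pow_comm (Kinv_F hd hζ), q_comm_pow _ (zKinv_Estar hd hζ), mul_smul_comm,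
    TensorProduct.tmul_smul, ← TensorProduct.smul_tmul', ← sub_eq_iff_eq_add', ← smul_sub,
    ← TensorProduct.sub_tmul, ← mul_assoc, ← mul_assoc, ← sub_mul, E_pow_F,
    pow_succ (Estar hd hζ), mul_assoc (Estar hd hζ ^ n), Estar_mul_zKinv, mul_smul_comm,
    TensorProduct.tmul_smul, smul_smul, smul_mul_assoc, ← TensorProduct.smul_tmul', smul_comm,
    TensorProduct.smul_tmul', pow_succ ζ, mul_assoc (ζ ^ n), mul_inv_cancel₀ h0, mul_one]
  congr 2
  have e1 : z hd hζ * Kinv hd hζ * Kinv hd hζ ^ (n + 1)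
      = Kinv hd hζ ^ n * (z hd hζ * Kinv hd hζ * Kinv hd hζ) := by
    rw [mul_assoc (z hd hζ), mul_assoc (z hd hζ), ← mul_assoc (Kinv hd hζ ^ n), ← z_comm,
      mul_assoc (z hd hζ), ← pow_succ', ← pow_two, ← pow_add]
  have e2 : K hd hζ * Kinv hd hζ ^ (n + 1) = Kinv hd hζ ^ n := by
    rw [pow_succ', ← mul_assoc, K_mul_Kinv, one_mul]
  rw [mul_assoc, mul_assoc, sub_mul, smul_mul_assoc, e1, e2, mul_sub (Kinv hd hζ ^ n),
    mul_smul_comm, mul_one, ← mul_smul_comm, smul_sub, smul_smul, ← mul_pow, mul_inv_cancel₀ h0,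
    one_pow, one_smul]

/-- The coefficients `θ n` satisfy `θ (n+1) (n+1)_ζ = θ n`, so the corrections `G n` from degree `n
+ 1` on one side match those from degree `n` on the other. -/
theorem quasiR_comm : quasiR hd hζ * (F hd hζ ⊗ₜ[ℂ] (z hd hζ * Kinv hd hζ)
      + (z hd hζ * Kinv hd hζ * Kinv hd hζ) ⊗ₜ[ℂ] F hd hζ)
    = ((1 : DB hd hζ) ⊗ₜ[ℂ] F hd hζ + F hd hζ ⊗ₜ[ℂ] (z hd hζ * Kinv hd hζ)) * quasiR hd hζ := by
  obtain ⟨m, rfl⟩ : ∃ m, d = m + 1 := ⟨d - 1, by omega⟩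
  let G : ℕ → DB hd hζ ⊗[ℂ] DB hd hζ := fun n =>
    (E hd hζ ^ n * Kinv hd hζ ^ n * (ζ ^ n • 1 - z hd hζ * Kinv hd hζ * Kinv hd hζ))
          ⊗ₜ[ℂ] (Estar hd hζ ^ n * F hd hζ)
  let θ : ℕ → ℂ := fun n => (((m + 1 : ℕ) : ℂ) * qFact ζ n)⁻¹
  have h1 : quasiR hd hζ * (F hd hζ ⊗ₜ[ℂ] (z hd hζ * Kinv hd hζ))
      = (F hd hζ ⊗ₜ[ℂ] (z hd hζ * Kinv hd hζ)) * quasiR hd hζ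
        + ∑ n ∈ Finset.range m, θ n • G n := by
    rw [quasiR, Finset.sum_mul, Finset.mul_sum, Finset.sum_range_succ', Finset.sum_range_succ',
      add_right_comm, ← Finset.sum_add_distrib]
    congr 1
    · refine Finset.sum_congr rfl fun n hn => ?_
      rw [Finset.mem_range] at hn
      -- Since `n + 1 < d`, the number `(n+1)_ζ` cancels from the factorial.
      have hq : qNum ζ (n + 1) ≠ 0 := qNum_ne_zero hζ (by omega) (by omega)
      rw [smul_mul_assoc, quasiR_term_succ, smul_add, mul_smul_comm, smul_smul]
      congr 2
      simp only [θ, qFact, Finset.prod_range_succ]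
      field_simp
    · simp
  have h2 : ((1 : DB hd hζ) ⊗ₜ[ℂ] F hd hζ) * quasiR hd hζ
      = quasiR hd hζ * ((z hd hζ * Kinv hd hζ * Kinv hd hζ) ⊗ₜ[ℂ] F hd hζ)
        + ∑ n ∈ Finset.range m, θ n • G n := by
    -- Here `m = d - 1`: the top correction contains `(E*)^(d-1) F = 0`, so sums over `m` and over
    -- `m + 1` indices agree.
    have h3 : G m = 0 := by
      have := Estar_pow_mul_F hd hζ
      rw [Nat.add_sub_cancel] at this
      simp only [G, this, TensorProduct.tmul_zero]
    have h4 : ∑ n ∈ Finset.range m, θ n • G n = ∑ n ∈ Finset.range (m + 1), θ n • G n := by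
      rw [Finset.sum_range_succ, h3, smul_zero, add_zero]
    rw [h4, quasiR, Finset.sum_mul, Finset.mul_sum, ← Finset.sum_add_distrib]
    refine Finset.sum_congr rfl fun n _ => ?_
    rw [mul_smul_comm, smul_mul_assoc, ← smul_add, quasiR_term]
  rw [mul_add, h1, add_mul, h2]
  abel

/-- The relation `R Δ(F) = Δ^op(F) R`: the Cartan part first carries `Δ(F)` to an intermediate sum
of two tensors, and the nilpotent part carries that sum to `Δ^op(F)`. -/
theorem Rmat_mul_comul_F : Rmat hd hζ *
      (F hd hζ ⊗ₜ[ℂ] (1 : DB hd hζ) + (z hd hζ * Kinv hd hζ) ⊗ₜ[ℂ] F hd hζ)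
    = ((1 : DB hd hζ) ⊗ₜ[ℂ] F hd hζ + F hd hζ ⊗ₜ[ℂ] (z hd hζ * Kinv hd hζ)) * Rmat hd hζ := by
  have h : cartan hd hζ 0 * ((z hd hζ * Kinv hd hζ) ⊗ₜ[ℂ] F hd hζ)
      = ((z hd hζ * Kinv hd hζ * Kinv hd hζ) ⊗ₜ[ℂ] F hd hζ) * cartan hd hζ 0 := by
    have e : ((z hd hζ * Kinv hd hζ) ⊗ₜ[ℂ] F hd hζ)
        = ((z hd hζ * Kinv hd hζ) ⊗ₜ[ℂ] (1 : DB hd hζ)) * ((1 : DB hd hζ) ⊗ₜ[ℂ] F hd hζ) := by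
      rw [Algebra.TensorProduct.tmul_mul_tmul, one_mul, mul_one]
    rw [e, ← mul_assoc, cartan_mul_zKinv, mul_assoc, cartan_mul_one_F, ← mul_assoc,
      Algebra.TensorProduct.tmul_mul_tmul, one_mul]
  rw [Rmat_eq, mul_assoc, mul_add, cartan_mul_F_one, h, ← add_mul, ← mul_assoc, quasiR_comm,
    mul_assoc]

theorem dualBasis_K (i j : ℕ) : K hd hζ * dualBasis hd hζ i j
    = ζ⁻¹ ^ i • (dualBasis hd hζ i j * K hd hζ) := by
  have h : ∀ k, K hd hζ * Kstar hd hζ ^ k = Kstar hd hζ ^ k * K hd hζ := fun k =>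
    (Commute.pow_right (K_Kstar hd hζ) k).eq
  rw [dualBasis, mul_smul_comm, ← mul_assoc, q_comm_pow _ (K_Estar hd hζ), smul_mul_assoc,
    smul_mul_assoc, mul_assoc, mul_assoc, smul_comm]
  simp only [Finset.mul_sum, Finset.sum_mul, mul_smul_comm, smul_mul_assoc, h]

theorem E_pow_mul_K_pow_K (i j : ℕ) : K hd hζ * (E hd hζ ^ i * K hd hζ ^ j)
    = ζ ^ i • (E hd hζ ^ i * K hd hζ ^ j * K hd hζ) := by
  rw [← mul_assoc, q_comm_pow _ (KE hd hζ), smul_mul_assoc, mul_assoc, mul_assoc, pow_mul_comm']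

theorem Rmat_K : (K hd hζ ⊗ₜ[ℂ] K hd hζ) * Rmat hd hζ = Rmat hd hζ * (K hd hζ ⊗ₜ[ℂ] K hd hζ) := by
  have h0 : ζ ≠ 0 := hζ.ne_zero (by omega)
  simp only [Rmat, Finset.mul_sum, Finset.sum_mul, Algebra.TensorProduct.tmul_mul_tmul,
    dualBasis_K, E_pow_mul_K_pow_K, TensorProduct.tmul_smul, ← TensorProduct.smul_tmul', smul_smul,
    ← mul_pow, inv_mul_cancel₀ h0, one_pow, one_smul]

/-- The double braiding element `τ(R) R`. -/
noncomputable def monodromy : DB hd hζ ⊗[ℂ] DB hd hζ :=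
  TensorProduct.comm ℂ (DB hd hζ) (DB hd hζ) (Rmat hd hζ) * Rmat hd hζ

/-- `R` turns `Δ(F)` into `Δ^op(F)`, and its flip turns it back. -/
theorem monodromy_F : monodromy hd hζ *
      (F hd hζ ⊗ₜ[ℂ] (1 : DB hd hζ) + (z hd hζ * Kinv hd hζ) ⊗ₜ[ℂ] F hd hζ)
    = (F hd hζ ⊗ₜ[ℂ] (1 : DB hd hζ) + (z hd hζ * Kinv hd hζ) ⊗ₜ[ℂ] F hd hζ)
      * monodromy hd hζ := by
  have h := congrArg (Algebra.TensorProduct.comm ℂ (DB hd hζ) (DB hd hζ)) (Rmat_mul_comul_F hd hζ)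
  simp only [map_mul, map_add, Algebra.TensorProduct.comm_tmul] at h
  change _ * Rmat hd hζ * _ = _ * (_ * Rmat hd hζ)
  rw [mul_assoc, Rmat_mul_comul_F, ← mul_assoc, ← mul_assoc]
  congr 1

theorem monodromy_K : monodromy hd hζ * (K hd hζ ⊗ₜ[ℂ] K hd hζ)
    = (K hd hζ ⊗ₜ[ℂ] K hd hζ) * monodromy hd hζ := by
  have h := congrArg (Algebra.TensorProduct.comm ℂ (DB hd hζ) (DB hd hζ)) (Rmat_K hd hζ)
  simp only [map_mul, Algebra.TensorProduct.comm_tmul] at h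
  change _ * Rmat hd hζ * _ = _ * (_ * Rmat hd hζ)
  rw [mul_assoc, ← Rmat_K, ← mul_assoc, ← mul_assoc]
  congr 1
  exact h.symm

end DB
end Intertwining

/-! ### Partial traces as contractions in `H ⊗ H`. -/

section Contraction
variable {H : Type} [Ring H] [Algebra ℂ H]

/-- The contraction `a ⊗ b ↦ T(b) a` of the right factor against a functional. -/
noncomputable def contractRight (T : H →ₗ[ℂ] ℂ) : H ⊗[ℂ] H →ₗ[ℂ] H :=
  (TensorProduct.rid ℂ H).toLinearMap ∘ₗ T.lTensor H

/-- The contraction `a ⊗ b ↦ T(a) b` of the left factor against a functional. -/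
noncomputable def contractLeft (T : H →ₗ[ℂ] ℂ) : H ⊗[ℂ] H →ₗ[ℂ] H :=
  (TensorProduct.lid ℂ H).toLinearMap ∘ₗ T.rTensor H

theorem contractRight_tmul (T : H →ₗ[ℂ] ℂ) (a b : H) : contractRight T (a ⊗ₜ b) = T b • a := by
  simp [contractRight]

theorem contractLeft_tmul (T : H →ₗ[ℂ] ℂ) (a b : H) : contractLeft T (a ⊗ₜ b) = T a • b := by
  simp [contractLeft]

/-- The factor on the contracted side is absorbed by the functional and the other one comes out.
With its three variants, this converts identities in `H ⊗ H` into identities in `H`. -/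
theorem contractRight_mul_tmul (T : H →ₗ[ℂ] ℂ) (t : H ⊗[ℂ] H) (x y : H) :
    contractRight T (t * (x ⊗ₜ y)) = contractRight (T ∘ₗ LinearMap.mulRight ℂ y) t * x := by
  induction t using TensorProduct.induction_on with
  | zero => simp
  | add t s ht hs => rw [add_mul, map_add, ht, hs, map_add, add_mul]
  | tmul a b => simp [contractRight_tmul]

theorem contractRight_tmul_mul (T : H →ₗ[ℂ] ℂ) (t : H ⊗[ℂ] H) (x y : H) :
    contractRight T ((x ⊗ₜ y) * t) = x * contractRight (T ∘ₗ LinearMap.mulLeft ℂ y) t := by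
  induction t using TensorProduct.induction_on with
  | zero => simp
  | add t s ht hs => rw [mul_add, map_add, ht, hs, map_add, mul_add]
  | tmul a b => simp [contractRight_tmul]

theorem contractLeft_mul_tmul (T : H →ₗ[ℂ] ℂ) (t : H ⊗[ℂ] H) (x y : H) :
    contractLeft T (t * (x ⊗ₜ y)) = contractLeft (T ∘ₗ LinearMap.mulRight ℂ x) t * y := by
  induction t using TensorProduct.induction_on with
  | zero => simp
  | add t s ht hs => rw [add_mul, map_add, ht, hs, map_add, add_mul]
  | tmul a b => simp [contractLeft_tmul]

theorem contractLeft_tmul_mul (T : H →ₗ[ℂ] ℂ) (t : H ⊗[ℂ] H) (x y : H) :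
    contractLeft T ((x ⊗ₜ y) * t) = y * contractLeft (T ∘ₗ LinearMap.mulLeft ℂ x) t := by
  induction t using TensorProduct.induction_on with
  | zero => simp
  | add t s ht hs => rw [mul_add, map_add, ht, hs, map_add, mul_add]
  | tmul a b => simp [contractLeft_tmul]

theorem contractRight_smul (q : ℂ) (T : H →ₗ[ℂ] ℂ) (t : H ⊗[ℂ] H) :
    contractRight (q • T) t = q • contractRight T t := by
  simp [contractRight, LinearMap.lTensor_smul]

theorem contractLeft_smul (q : ℂ) (T : H →ₗ[ℂ] ℂ) (t : H ⊗[ℂ] H) :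
    contractLeft (q • T) t = q • contractLeft T t := by
  simp [contractLeft, LinearMap.rTensor_smul]

theorem contractRight_sum {ι : Type*} (s : Finset ι) (T : ι → H →ₗ[ℂ] ℂ) (t : H ⊗[ℂ] H) :
    contractRight (∑ i ∈ s, T i) t = ∑ i ∈ s, contractRight (T i) t := by
  induction t using TensorProduct.induction_on with
  | zero => simp
  | add t s ht hs => simp only [map_add, ht, hs, Finset.sum_add_distrib]
  | tmul a b => simp [contractRight_tmul, Finset.sum_smul]

theorem contractLeft_sum {ι : Type*} (s : Finset ι) (T : ι → H →ₗ[ℂ] ℂ) (t : H ⊗[ℂ] H) :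
    contractLeft (∑ i ∈ s, T i) t = ∑ i ∈ s, contractLeft (T i) t := by
  induction t using TensorProduct.induction_on with
  | zero => simp
  | add t s ht hs => simp only [map_add, ht, hs, Finset.sum_add_distrib]
  | tmul a b => simp [contractLeft_tmul, Finset.sum_smul]

/-- The trace functional of a module. -/
noncomputable def FDMod.tr (M : FDMod H) : H →ₗ[ℂ] ℂ := LinearMap.trace ℂ M.V ∘ₗ M.ρ.toLinearMap

theorem FDMod.tr_mul_comm (M : FDMod H) (a b : H) : M.tr (a * b) = M.tr (b * a) := by
  simp only [FDMod.tr, LinearMap.comp_apply, AlgHom.toLinearMap_apply, map_mul]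
  exact LinearMap.trace_mul_comm ℂ _ _

/-- The partial trace is the action of an element of `H` itself, so that scalarity and evaluation
can be studied through that element. -/
theorem rightTr_act₂ (g : Hˣ) (X M : FDMod H) (t : H ⊗[ℂ] H) :
    rightTr (M.pivotal g) (act₂ X.ρ M.ρ t)
      = X.ρ (contractRight (M.tr ∘ₗ LinearMap.mulLeft ℂ (g : H)) t) := by
  induction t using TensorProduct.induction_on with
  | zero => simp only [map_zero, rightTr_zero]
  | add x y hx hy => simp only [map_add, rightTr_add, hx, hy]
  | tmul a b =>
    rw [act₂_tmul, FDMod.pivotal, rightTr_map, contractRight_tmul, map_smul, LinearMap.comp_apply,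
      LinearMap.mulLeft_apply, FDMod.tr, LinearMap.comp_apply, AlgHom.toLinearMap_apply, map_mul]
    rfl

theorem leftTr_act₂ (g : Hˣ) (X M : FDMod H) (t : H ⊗[ℂ] H) :
    leftTr (M.pivotal g) (act₂ M.ρ X.ρ t)
      = X.ρ (contractLeft (M.tr ∘ₗ LinearMap.mulRight ℂ ((g⁻¹ : Hˣ) : H)) t) := by
  induction t using TensorProduct.induction_on with
  | zero => simp only [map_zero, leftTr_zero]
  | add x y hx hy => simp only [map_add, leftTr_add, hx, hy]
  | tmul a b =>
    rw [act₂_tmul, FDMod.pivotal, leftTr_map, contractLeft_tmul, map_smul, LinearMap.comp_apply,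
      LinearMap.mulRight_apply, FDMod.tr, LinearMap.comp_apply, AlgHom.toLinearMap_apply, map_mul]
    rfl

end Contraction

/-! ### Fourier inversion on `ℤ/d`. -/

section Fourier
variable {d : ℕ} {ζ : ℂ}

/-- Orthogonality of characters: the coefficient of `y^k` is a geometric sum, equal to `d` when `k`
is the residue of `a` and to zero otherwise. -/
theorem fourier_inversion (hd : 2 ≤ d) (hζ : IsPrimitiveRoot ζ d) {A : Type*} [Ring A]
    [Algebra ℂ A] {y : A} (hy : y ^ d = 1) (a : ℕ) :
    ∑ k ∈ Finset.range d, ((d : ℂ)⁻¹ * ∑ j ∈ Finset.range d, ζ⁻¹ ^ (k * j) * ζ ^ (a * j)) • y ^ k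
      = y ^ a := by
  have h0 : ζ ≠ 0 := hζ.ne_zero (by omega)
  have hd0 : (d : ℂ) ≠ 0 := by exact_mod_cast (by omega : d ≠ 0)
  have hlt : a % d < d := Nat.mod_lt _ (by omega)
  have hw : ∀ k, ∑ j ∈ Finset.range d, ζ⁻¹ ^ (k * j) * ζ ^ (a * j)
      = ∑ j ∈ Finset.range d, (ζ⁻¹ ^ k * ζ ^ (a % d)) ^ j := fun k =>
    Finset.sum_congr rfl fun j _ => by
      rw [mul_pow, ← pow_mul, pow_mul ζ a j, pow_eq_pow_mod a hζ.pow_eq_one]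
  rw [Finset.sum_eq_single (a % d)]
  · rw [hw, ← mul_pow, inv_mul_cancel₀ h0]
    simp [hd0, ← pow_eq_pow_mod a hy]
  · intro k hk hne
    rw [Finset.mem_range] at hk
    have h1 : ζ⁻¹ ^ k * ζ ^ (a % d) - 1 ≠ 0 := by
      intro h
      rw [sub_eq_zero, inv_pow, inv_mul_eq_one₀ (pow_ne_zero _ h0)] at h
      exact hne (hζ.pow_inj hk hlt h)
    have h2 : (∑ j ∈ Finset.range d, (ζ⁻¹ ^ k * ζ ^ (a % d)) ^ j) * (ζ⁻¹ ^ k * ζ ^ (a % d) - 1)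
        = 0 := by
      rw [geom_sum_mul, mul_pow, ← pow_mul, ← pow_mul, mul_comm k, mul_comm (a % d), pow_mul,
        pow_mul, inv_pow, hζ.pow_eq_one]
      simp
    rw [hw, (mul_eq_zero.1 h2).resolve_right h1, mul_zero, zero_smul]
  · intro h
    exact absurd (Finset.mem_range.2 hlt) h

end Fourier

/-! ### Commutation of the contracted monodromy with `K` and `F`. -/

section Central
variable {d : ℕ} {ζ : ℂ} (hd : 2 ≤ d) (hζ : IsPrimitiveRoot ζ d)

namespace DB

/-- The monodromy is invariant under conjugation by `K ⊗ K`, so a weight of the functional under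
conjugation becomes a weight of the contracted element. The case `q = 1` gives commutation with `K`;
the case `q = ζ` serves for `F`. -/
theorem contractRight_mul_K {U : DB hd hζ →ₗ[ℂ] ℂ} {q : ℂ}
    (hU : ∀ b, U (K hd hζ * b * Kinv hd hζ) = q * U b) :
    contractRight U (monodromy hd hζ) * K hd hζ
      = q • (K hd hζ * contractRight U (monodromy hd hζ)) := by
  have h := congrArg (contractRight (U ∘ₗ LinearMap.mulRight ℂ (Kinv hd hζ))) (monodromy_K hd hζ)
  rw [contractRight_mul_tmul, contractRight_tmul_mul] at h
  have e1 : (U ∘ₗ LinearMap.mulRight ℂ (Kinv hd hζ)) ∘ₗ LinearMap.mulRight ℂ (K hd hζ) = U := by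
    ext b; simp [mul_assoc, K_mul_Kinv]
  have e2 : (U ∘ₗ LinearMap.mulRight ℂ (Kinv hd hζ)) ∘ₗ LinearMap.mulLeft ℂ (K hd hζ) = q • U := by
    ext b; simp [hU]
  rw [e1, e2, contractRight_smul, mul_smul_comm] at h
  exact h

theorem contractLeft_mul_K {U : DB hd hζ →ₗ[ℂ] ℂ}
    (hU : ∀ b, U (K hd hζ * b * Kinv hd hζ) = U b) :
    contractLeft U (monodromy hd hζ) * K hd hζ
      = K hd hζ * contractLeft U (monodromy hd hζ) := by
  have h := congrArg (contractLeft (U ∘ₗ LinearMap.mulRight ℂ (Kinv hd hζ))) (monodromy_K hd hζ)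
  rw [contractLeft_mul_tmul, contractLeft_tmul_mul] at h
  have e1 : (U ∘ₗ LinearMap.mulRight ℂ (Kinv hd hζ)) ∘ₗ LinearMap.mulRight ℂ (K hd hζ) = U := by
    ext b; simp [mul_assoc, K_mul_Kinv]
  have e2 : (U ∘ₗ LinearMap.mulRight ℂ (Kinv hd hζ)) ∘ₗ LinearMap.mulLeft ℂ (K hd hζ) = U := by
    ext b; simp [hU]
  rw [e1, e2] at h
  exact h

theorem pivot_val : ((pivot hd hζ : (DB hd hζ)ˣ) : DB hd hζ) = zinv hd hζ * K hd hζ := rfl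
theorem pivot_inv : (((pivot hd hζ)⁻¹ : (DB hd hζ)ˣ) : DB hd hζ) = z hd hζ * Kinv hd hζ :=
  (zKinv hd hζ).symm

theorem K_mul_pivot : K hd hζ * (zinv hd hζ * K hd hζ) = zinv hd hζ * K hd hζ * K hd hζ := by
  rw [← mul_assoc, zinv_comm]

variable (T : DB hd hζ →ₗ[ℂ] ℂ) (hT : ∀ a b, T (a * b) = T (b * a))
include hT

theorem trace_pivot_conj (b : DB hd hζ) :
    T (zinv hd hζ * K hd hζ * (K hd hζ * b * Kinv hd hζ)) = T (zinv hd hζ * K hd hζ * b) := by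
  rw [← mul_assoc, hT, ← mul_assoc (zinv hd hζ * K hd hζ), ← K_mul_pivot, mul_assoc (K hd hζ),
    ← mul_assoc, Kinv_mul_K, one_mul]

theorem trace_conj_pivot_inv (b : DB hd hζ) :
    T (K hd hζ * b * Kinv hd hζ * (z hd hζ * Kinv hd hζ)) = T (b * (z hd hζ * Kinv hd hζ)) := by
  rw [mul_assoc, mul_assoc, hT, ← mul_assoc (Kinv hd hζ), zKinv, mul_assoc, mul_assoc, mul_assoc,
    Kinv_mul_K, mul_one, ← zKinv]

/-- Contracting `[τ(R) R, Δ(F)] = 0` gives the wanted commutator with `F` plus a contribution of `z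
K⁻¹ ⊗ F`. The pivot is what makes that contribution vanish: the factor `ζ⁻¹` it produces when
passing `F` compensates the weight of the contracted element. -/
theorem contractRight_pivot_F :
    contractRight (T ∘ₗ LinearMap.mulLeft ℂ (zinv hd hζ * K hd hζ)) (monodromy hd hζ) * F hd hζ
      = F hd hζ
        * contractRight (T ∘ₗ LinearMap.mulLeft ℂ (zinv hd hζ * K hd hζ)) (monodromy hd hζ) := by
  have h0 : ζ ≠ 0 := hζ.ne_zero (by omega)
  set P := T ∘ₗ LinearMap.mulLeft ℂ (zinv hd hζ * K hd hζ) with hP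
  have h := congrArg (contractRight P) (monodromy_F hd hζ)
  rw [mul_add, add_mul, map_add, map_add, contractRight_mul_tmul, contractRight_mul_tmul,
    contractRight_tmul_mul, contractRight_tmul_mul] at h
  have e1 : P ∘ₗ LinearMap.mulRight ℂ (1 : DB hd hζ) = P := by ext; simp
  have e2 : P ∘ₗ LinearMap.mulLeft ℂ (1 : DB hd hζ) = P := by ext; simp
  have e3 : P ∘ₗ LinearMap.mulLeft ℂ (F hd hζ) = ζ⁻¹ • (P ∘ₗ LinearMap.mulRight ℂ (F hd hζ)) := by
    ext b
    have : zinv hd hζ * K hd hζ * (F hd hζ * b)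
        = ζ⁻¹ • (F hd hζ * (zinv hd hζ * K hd hζ * b)) := by
      rw [← mul_assoc, mul_assoc (zinv hd hζ), KF, mul_smul_comm, smul_mul_assoc, ← mul_assoc,
        zinv_comm]
      simp only [mul_assoc]
    simp only [hP, LinearMap.comp_apply, LinearMap.mulLeft_apply, LinearMap.smul_apply,
      LinearMap.mulRight_apply, this, map_smul]
    rw [hT]
    simp only [mul_assoc]
  rw [e1, e2, e3, contractRight_smul] at h
  have hU : ∀ b, (P ∘ₗ LinearMap.mulRight ℂ (F hd hζ)) (K hd hζ * b * Kinv hd hζ)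
      = ζ * (P ∘ₗ LinearMap.mulRight ℂ (F hd hζ)) b := fun b => by
    have : K hd hζ * b * Kinv hd hζ * F hd hζ = ζ • (K hd hζ * (b * F hd hζ) * Kinv hd hζ) := by
      rw [mul_assoc, Kinv_F, mul_smul_comm]
      simp only [mul_assoc]
    simp only [LinearMap.comp_apply, LinearMap.mulRight_apply, this, map_smul, smul_eq_mul]
    rw [hP, LinearMap.comp_apply, LinearMap.mulLeft_apply, trace_pivot_conj hd hζ T hT]
    rfl
  have hK := contractRight_mul_K hd hζ hU
  set y := contractRight (P ∘ₗ LinearMap.mulRight ℂ (F hd hζ)) (monodromy hd hζ)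
  -- From `y K = ζ K y`; the resulting `ζ⁻¹` is the one that appears in `e3`.
  have hy : y * (z hd hζ * Kinv hd hζ) = z hd hζ * Kinv hd hζ * ζ⁻¹ • y := by
    have h1 : Kinv hd hζ * (y * K hd hζ) * Kinv hd hζ
        = Kinv hd hζ * (ζ • (K hd hζ * y)) * Kinv hd hζ := by rw [hK]
    rw [mul_assoc, mul_assoc, K_mul_Kinv, mul_one, mul_smul_comm, ← mul_assoc, Kinv_mul_K, one_mul,
      smul_mul_assoc] at h1
    rw [mul_smul_comm, mul_assoc (z hd hζ), h1, mul_smul_comm, smul_smul, inv_mul_cancel₀ h0,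
      one_smul, ← mul_assoc, ← z_comm, mul_assoc]
  rw [hy] at h
  exact add_right_cancel h

/-- Here the plain functional `T` is contracted: by cyclicity the term `F ⊗ 1` contributes equally
on both sides, and the term `z K⁻¹ ⊗ F` of `Δ(F)` supplies the inverse pivot `z K⁻¹`. -/
theorem contractLeft_pivot_F :
    contractLeft (T ∘ₗ LinearMap.mulRight ℂ (z hd hζ * Kinv hd hζ)) (monodromy hd hζ) * F hd hζ
      = F hd hζ
        * contractLeft (T ∘ₗ LinearMap.mulRight ℂ (z hd hζ * Kinv hd hζ)) (monodromy hd hζ) := by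
  have h := congrArg (contractLeft T) (monodromy_F hd hζ)
  rw [mul_add, add_mul, map_add, map_add, contractLeft_mul_tmul, contractLeft_mul_tmul,
    contractLeft_tmul_mul, contractLeft_tmul_mul] at h
  have e : ∀ x : DB hd hζ, T ∘ₗ LinearMap.mulLeft ℂ x = T ∘ₗ LinearMap.mulRight ℂ x := fun x => by
    ext b; simp [hT x b]
  rw [e, e, mul_one, one_mul] at h
  exact add_left_cancel h

omit hT

/-! ### Evaluation of the contracted monodromy on extremal vectors. -/

section Evaluation
variable {V : Type} [AddCommGroup V] [Module ℂ V] (φ : DB hd hζ →ₐ[ℂ] Module.End ℂ V) {v : V}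

theorem pow_apply_eigen {f : Module.End ℂ V} {x : ℂ} (h : f v = x • v) (n : ℕ) :
    (f ^ n) v = x ^ n • v := by
  induction n with
  | zero => simp
  | succ n ih => rw [pow_succ, Module.End.mul_apply, h, map_smul, ih, smul_smul, pow_succ']

theorem dualBasis_zero (j : ℕ) : dualBasis hd hζ 0 j
    = ∑ k ∈ Finset.range d, ((d : ℂ)⁻¹ * ζ⁻¹ ^ (k * j)) • Kstar hd hζ ^ k := by
  simp [dualBasis, qFact, Finset.smul_sum, smul_smul]

/-- The elements `β_{0,j}` are the Fourier transforms of the powers of `K*`, so this is Fourier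
inversion. -/
theorem sum_dualBasis_zero (a : ℕ) :
    ∑ j ∈ Finset.range d, ζ ^ (a * j) • dualBasis hd hζ 0 j = Kstar hd hζ ^ a := by
  rw [← fourier_inversion hd hζ (Kstar_pow hd hζ) a]
  simp only [dualBasis_zero, Finset.smul_sum, Finset.mul_sum, Finset.sum_smul, smul_smul]
  rw [Finset.sum_comm]
  refine Finset.sum_congr rfl fun k _ => Finset.sum_congr rfl fun j _ => ?_
  congr 1
  ring

theorem dualBasis_zero_apply {b : ℕ} (hv : φ (Kstar hd hζ) v = ζ ^ b • v) (j : ℕ) :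
    φ (dualBasis hd hζ 0 j) v
      = ((d : ℂ)⁻¹ * ∑ k ∈ Finset.range d, ζ⁻¹ ^ (j * k) * ζ ^ (b * k)) • v := by
  simp only [dualBasis_zero, map_sum, map_smul, map_pow, LinearMap.sum_apply, LinearMap.smul_apply,
    pow_apply_eigen hv, Finset.mul_sum, Finset.sum_smul, smul_smul, ← pow_mul, mul_assoc,
    mul_comm j]

theorem dualBasis_apply_of_F {c : ℂ} (hF : φ (F hd hζ) v = 0) (hv : φ (Kstar hd hζ) v = c • v)
    {i : ℕ} (hi : i ≠ 0) (j : ℕ) : φ (dualBasis hd hζ i j) v = 0 := by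
  obtain ⟨n, rfl⟩ := Nat.exists_eq_succ_of_ne_zero hi
  have hE : φ (Estar hd hζ) v = 0 := by
    rw [Estar, map_smul, map_mul, LinearMap.smul_apply, Module.End.mul_apply, hv, map_smul, hF]
    simp
  have h : ∀ k, (φ (Kstar hd hζ) ^ k) v = c ^ k • v := pow_apply_eigen hv
  simp only [dualBasis, map_smul, map_mul, map_pow, map_sum, LinearMap.smul_apply,
    Module.End.mul_apply, LinearMap.sum_apply, h, pow_succ, hE, map_zero, smul_zero,
    Finset.sum_const_zero]

/-- Only the terms with `i = 0` survive in both copies of `R`: in the right one because `E` kills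
`v`, in the left one by the hypothesis `hU`, which holds for weight reasons in the application. The
Cartan sums then collapse by Fourier inversion. -/
theorem contractRight_monodromy_apply {a b : ℕ} (hE : φ (E hd hζ) v = 0)
    (hK : φ (K hd hζ) v = ζ ^ a • v) (hv : φ (Kstar hd hζ) v = ζ ^ b • v)
    (hU : ∀ i j, i ≠ 0 → i < d → T (E hd hζ ^ i * K hd hζ ^ j * Kstar hd hζ ^ a) = 0) :
    φ (contractRight T (monodromy hd hζ)) v = T (K hd hζ ^ b * Kstar hd hζ ^ a) • v := by
  have hd0 : 0 ∈ Finset.range d := Finset.mem_range.2 (by omega)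
  -- The right copy of `R` acts first: on `v` its left factor `K^j` is the scalar `ζ^(aj)`, and the
  -- sum over `j` of the right factors is `(K*)^a`.
  have h1 : ∀ s, φ (contractRight T (s * Rmat hd hζ)) v
      = φ (contractRight (T ∘ₗ LinearMap.mulRight ℂ (Kstar hd hζ ^ a)) s) v := by
    intro s
    have e : T ∘ₗ LinearMap.mulRight ℂ (Kstar hd hζ ^ a)
        = ∑ j ∈ Finset.range d, ζ ^ (a * j) • (T ∘ₗ LinearMap.mulRight ℂ (dualBasis hd hζ 0 j)) := by
      rw [← sum_dualBasis_zero]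
      ext x
      simp [Finset.mul_sum]
    rw [e, contractRight_sum, map_sum, LinearMap.sum_apply]
    simp only [Rmat, Finset.mul_sum, map_sum, LinearMap.sum_apply]
    rw [Finset.sum_eq_single 0]
    · refine Finset.sum_congr rfl fun j _ => ?_
      rw [contractRight_mul_tmul, pow_zero, one_mul, map_mul, Module.End.mul_apply, map_pow,
        pow_apply_eigen hK, map_smul, contractRight_smul, map_smul, LinearMap.smul_apply, pow_mul]
    · intro i _ hi
      obtain ⟨n, rfl⟩ := Nat.exists_eq_succ_of_ne_zero hi
      refine Finset.sum_eq_zero fun j _ => ?_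
      rw [contractRight_mul_tmul, map_mul, Module.End.mul_apply, map_mul, Module.End.mul_apply,
        map_pow, map_pow, pow_apply_eigen hK, map_smul, pow_succ, Module.End.mul_apply, hE]
      simp
    · exact fun h => absurd hd0 h
  have h2 : K hd hζ ^ b = ∑ j ∈ Finset.range d,
      ((d : ℂ)⁻¹ * ∑ k ∈ Finset.range d, ζ⁻¹ ^ (j * k) * ζ ^ (b * k)) • K hd hζ ^ j :=
    (fourier_inversion hd hζ (K_pow hd hζ) b).symm
  rw [monodromy, h1, Rmat, h2]
  simp only [map_sum, TensorProduct.comm_tmul, LinearMap.sum_apply, contractRight_tmul,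
    Finset.sum_mul, Finset.sum_smul, smul_mul_assoc, map_smul, LinearMap.smul_apply]
  rw [Finset.sum_eq_single 0]
  · refine Finset.sum_congr rfl fun j _ => ?_
    rw [dualBasis_zero_apply hd hζ φ hv, pow_zero, one_mul, smul_smul, smul_eq_mul, mul_comm]
    rfl
  · intro i hi hi0
    refine Finset.sum_eq_zero fun j _ => ?_
    rw [LinearMap.comp_apply, LinearMap.mulRight_apply, hU i j hi0 (Finset.mem_range.1 hi),
      zero_smul]
  · exact fun h => absurd hd0 h

/-- The mirror computation: `v` now sits in the right factor, so the nilpotent terms die through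
`E*`, a multiple of `F K*`, and the copy of `R` acting first collapses to `K^b`. -/
theorem contractLeft_monodromy_apply {a b : ℕ} (hF : φ (F hd hζ) v = 0)
    (hK : φ (K hd hζ) v = ζ ^ a • v) (hv : φ (Kstar hd hζ) v = ζ ^ b • v)
    (hU : ∀ i j, i ≠ 0 → i < d → T (dualBasis hd hζ i j * K hd hζ ^ b) = 0) :
    φ (contractLeft T (monodromy hd hζ)) v = T (Kstar hd hζ ^ a * K hd hζ ^ b) • v := by
  have hd0 : 0 ∈ Finset.range d := Finset.mem_range.2 (by omega)
  have h2 : K hd hζ ^ b = ∑ j ∈ Finset.range d,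
      ((d : ℂ)⁻¹ * ∑ k ∈ Finset.range d, ζ⁻¹ ^ (j * k) * ζ ^ (b * k)) • K hd hζ ^ j :=
    (fourier_inversion hd hζ (K_pow hd hζ) b).symm
  have h1 : ∀ s, φ (contractLeft T (s * Rmat hd hζ)) v
      = φ (contractLeft (T ∘ₗ LinearMap.mulRight ℂ (K hd hζ ^ b)) s) v := by
    intro s
    have e : T ∘ₗ LinearMap.mulRight ℂ (K hd hζ ^ b) = ∑ j ∈ Finset.range d,
        ((d : ℂ)⁻¹ * ∑ k ∈ Finset.range d, ζ⁻¹ ^ (j * k) * ζ ^ (b * k)) •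
          (T ∘ₗ LinearMap.mulRight ℂ (K hd hζ ^ j)) := by
      rw [h2]
      ext x
      simp only [LinearMap.comp_apply, LinearMap.mulRight_apply, Finset.mul_sum, mul_smul_comm,
        map_sum, map_smul, LinearMap.sum_apply, LinearMap.smul_apply]
    rw [e, contractLeft_sum, map_sum, LinearMap.sum_apply]
    simp only [Rmat, Finset.mul_sum (Finset.range d) _ s, map_sum, LinearMap.sum_apply]
    rw [Finset.sum_eq_single 0]
    · refine Finset.sum_congr rfl fun j _ => ?_
      rw [contractLeft_mul_tmul, pow_zero, one_mul, map_mul, Module.End.mul_apply,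
        dualBasis_zero_apply hd hζ φ hv, map_smul, contractLeft_smul, map_smul,
        LinearMap.smul_apply]
    · intro i _ hi
      refine Finset.sum_eq_zero fun j _ => ?_
      rw [contractLeft_mul_tmul, map_mul, Module.End.mul_apply,
        dualBasis_apply_of_F hd hζ φ hF hv hi, map_zero]
    · exact fun h => absurd hd0 h
  rw [monodromy, h1, Rmat, ← sum_dualBasis_zero]
  simp only [map_sum, TensorProduct.comm_tmul, LinearMap.sum_apply, contractLeft_tmul,
    Finset.sum_mul, Finset.sum_smul, smul_mul_assoc, map_smul, LinearMap.smul_apply]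
  rw [Finset.sum_eq_single 0]
  · refine Finset.sum_congr rfl fun j _ => ?_
    rw [pow_zero, one_mul, map_pow, pow_apply_eigen hK, smul_smul, ← pow_mul, smul_eq_mul, mul_comm]
    rfl
  · intro i hi hi0
    refine Finset.sum_eq_zero fun j _ => ?_
    rw [LinearMap.comp_apply, LinearMap.mulRight_apply, hU i j hi0 (Finset.mem_range.1 hi),
      zero_smul]
  · exact fun h => absurd hd0 h

end Evaluation
end DB
end Central

/-! ### The action on `M_λ` and the values of `s^±`. -/

section SimpleAction
variable {d : ℕ} {ζ : ℂ} (hd : 2 ≤ d) (hζ : IsPrimitiveRoot ζ d)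

theorem toIcc_cast (hd : 2 ≤ d) (a : ZMod d) : ((toIcc a : ℕ) : ZMod d) = a := by
  have : NeZero d := ⟨by omega⟩
  unfold toIcc
  split_ifs with h
  · rw [ZMod.natCast_self, (ZMod.val_eq_zero a).1 h]
  · exact ZMod.natCast_zmod_val a

namespace DB

/-- Inverses are powers with exponent `d - 1`; comparing exponents in `ZMod d` restores the usual
calculus with negative exponents. -/
theorem pow_eq_of_cast {A : Type*} [Monoid A] {x : A} (hx : x ^ d = 1) {m n : ℕ}
    (h : (m : ZMod d) = n) : x ^ m = x ^ n := by
  rw [ZMod.natCast_eq_natCast_iff] at h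
  rw [pow_eq_pow_mod m hx, h, ← pow_eq_pow_mod n hx]

variable (T : DB hd hζ →ₗ[ℂ] ℂ)

theorem trace_eq_zero_of_weight (hT : ∀ a b, T (a * b) = T (b * a)) {x : DB hd hζ} {q : ℂ}
    (hq : q ≠ 1) (hx : K hd hζ * x = q • (x * K hd hζ)) : T x = 0 := by
  have h : T (K hd hζ * x * Kinv hd hζ) = q * T x := by
    rw [hx, smul_mul_assoc, mul_assoc, K_mul_Kinv, mul_one, map_smul, smul_eq_mul]
  rw [mul_assoc, hT, mul_assoc, Kinv_mul_K, mul_one] at h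
  have h1 : (1 - q) * T x = 0 := by linear_combination h
  exact (mul_eq_zero.1 h1).resolve_left (sub_ne_zero.2 hq.symm)

/-- The argument on the left is `z^(-1-a) K^(1+a+b)`. The symmetry `trace_K_pow` replaces the power
of `K` by `z^(1+a+b) K^(-1-a-b)`, which leaves `z^b`. -/
theorem trace_pivot_mul (hT : ∀ a b, T (a * b) = T (b * a)) {a b m n : ℕ}
    (h1 : (m : ZMod d) + (1 + a + b) = 0) (h2 : (n : ZMod d) = b) :
    T (zinv hd hζ * K hd hζ * (K hd hζ ^ b * Kstar hd hζ ^ a))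
      = T (K hd hζ ^ m * z hd hζ ^ n) := by
  have zc : ∀ x, Commute (zinv hd hζ) x := zinv_comm hd hζ
  have hd1 : ((d - 1 : ℕ) : ZMod d) = -1 := by
    rw [Nat.cast_sub (by omega)]; simp
  have e1 : zinv hd hζ * K hd hζ * (K hd hζ ^ b * Kstar hd hζ ^ a)
      = zinv hd hζ ^ (1 + a) * K hd hζ ^ (1 + a + b) := by
    rw [Kstar, (zc _).symm.mul_pow, ← ((zc (K hd hζ ^ a)).pow_left a).eq, mul_assoc (zinv hd hζ),
      ← mul_assoc (K hd hζ ^ b), ← ((zc (K hd hζ ^ b)).pow_left a).eq, mul_assoc _ (K hd hζ ^ b),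
      ← mul_assoc (K hd hζ), ← ((zc (K hd hζ)).pow_left a).eq, mul_assoc _ (K hd hζ), ← mul_assoc,
      ← pow_succ', ← pow_add, ← pow_succ', add_comm 1 a]
    congr 2
    ring
  rw [e1, trace_K_pow hd hζ T hT _ _ (fun x => ((zc x).pow_left _).eq), zinv, Kinv, ← pow_mul,
    ← pow_mul, ← mul_assoc, ← pow_add, hT,
    pow_eq_of_cast (K_pow hd hζ) (n := m), pow_eq_of_cast (z_pow hd hζ) (n := n)]
  · push_cast
    rw [hd1, h2]
    ring
  · push_cast
    rw [hd1]
    linear_combination -h1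

theorem mul_pivot_inv {a b m n : ℕ} (h1 : (m : ZMod d) + 1 = a + b)
    (h2 : (n : ZMod d) + a = 1) :
    Kstar hd hζ ^ a * K hd hζ ^ b * (z hd hζ * Kinv hd hζ) = K hd hζ ^ m * z hd hζ ^ n := by
  have zc : ∀ x, Commute (zinv hd hζ) x := zinv_comm hd hζ
  have hd1 : ((d - 1 : ℕ) : ZMod d) = -1 := by
    rw [Nat.cast_sub (by omega)]; simp
  rw [Kstar, (zc _).symm.mul_pow, mul_assoc (K hd hζ ^ a), ((zc _).pow_left a).eq, zKinv, mul_assoc,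
    mul_assoc, ← mul_assoc _ (Kinv hd hζ), ((zc (Kinv hd hζ)).pow_left a).eq, mul_assoc (Kinv hd hζ),
    ← mul_assoc (K hd hζ ^ b), ← mul_assoc (K hd hζ ^ a), zinv, Kinv, ← pow_mul, ← pow_succ,
    ← pow_add, ← pow_add, pow_eq_of_cast (K_pow hd hζ) (n := m),
    pow_eq_of_cast (z_pow hd hζ) (n := n)]
  · push_cast
    rw [hd1]
    linear_combination -h2
  · push_cast
    rw [hd1]
    linear_combination -h1

end DB

/-- Commuting with `K`, whose eigenvalues are distinct because `l ≤ d`, forces a diagonal matrix.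
Commuting with `F` makes consecutive diagonal entries equal, so any one basis vector determines the
scalar. -/
theorem eq_smul_id_of_commute (hζ : IsPrimitiveRoot ζ d) {l : ℕ} (hl : l ≤ d) (p : ℕ)
    (f : Module.End ℂ (Fin l → ℂ))
    (hK : f * Matrix.toLinAlgEquiv' (matK ζ l p) = Matrix.toLinAlgEquiv' (matK ζ l p) * f)
    (hF : f * Matrix.toLinAlgEquiv' (matF l) = Matrix.toLinAlgEquiv' (matF l) * f)
    (i₀ : Fin l) (c : ℂ) (h₀ : f (Pi.single i₀ 1) = c • Pi.single i₀ 1) :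
    f = c • LinearMap.id := by
  have hd0 : d ≠ 0 := by have := i₀.isLt; omega
  have h0 : ζ ≠ 0 := hζ.ne_zero hd0
  set A := LinearMap.toMatrixAlgEquiv' f with hA
  have hf : f = Matrix.toLinAlgEquiv' A := (Matrix.toLinAlgEquiv'_toMatrixAlgEquiv' f).symm
  rw [hf, ← map_mul, ← map_mul] at hK hF
  have hK' := Matrix.toLinAlgEquiv'.injective hK
  have hF' := Matrix.toLinAlgEquiv'.injective hF
  have hoff : ∀ i j, i ≠ j → A i j = 0 := by
    intro i j hij
    have h := congrFun (congrFun hK' i) j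
    rw [matK, Matrix.smul_mul, Matrix.mul_smul, Matrix.smul_apply, Matrix.smul_apply,
      Matrix.diagonal_mul, Matrix.mul_diagonal, smul_eq_mul, smul_eq_mul] at h
    have h1 := mul_left_cancel₀ (pow_ne_zero p h0) h
    by_contra hA0
    rw [mul_comm] at h1
    have h2 := hζ.pow_inj (by omega) (by omega) (mul_right_cancel₀ hA0 h1)
    exact hij (Fin.ext (by omega))
  have hstep : ∀ i j : Fin l, i.val = j.val + 1 → A i i = A j j := by
    intro i j hij
    have h := congrFun (congrFun hF' i) j
    rw [Matrix.mul_apply, Matrix.mul_apply, Finset.sum_eq_single i, Finset.sum_eq_single j] at h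
    · simpa [matF, hij] using h
    · intro k _ hk
      rw [hoff k j hk, mul_zero]
    · simp
    · intro k _ hk
      rw [hoff i k hk.symm, zero_mul]
    · simp
  have hconst : ∀ n (hn : n < l), A ⟨n, hn⟩ ⟨n, hn⟩ = A ⟨0, by omega⟩ ⟨0, by omega⟩ := by
    intro n
    induction n with
    | zero => exact fun _ => rfl
    | succ n ih => exact fun hn => (hstep ⟨n + 1, hn⟩ ⟨n, by omega⟩ rfl).trans (ih (by omega))
  have hc : A i₀ i₀ = c := by
    have h := congrFun h₀ i₀
    rw [hA, LinearMap.toMatrixAlgEquiv'_apply]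
    simpa using h
  have hAc : A = c • 1 := by
    ext i j
    by_cases hij : i = j
    · subst hij
      rw [hconst i.val i.isLt, ← hconst i₀.val i₀.isLt, hc]
      simp
    · rw [hoff i j hij]
      simp [hij]
  rw [hf, hAc, map_smul, map_one]
  rfl

variable {l : ℕ} (hl1 : 1 ≤ l) (hl2 : l ≤ d) (p : ZMod d)

theorem simpleMod_E : (simpleMod hd hζ hl1 hl2 p).ρ (DB.E hd hζ)
    = Matrix.toLinAlgEquiv' (matE ζ l p.val) :=
  congrArg (Matrix.toLinAlgEquiv' (R := ℂ) (n := Fin l)) (DB.lift_E hd hζ _)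
theorem simpleMod_F : (simpleMod hd hζ hl1 hl2 p).ρ (DB.F hd hζ)
    = Matrix.toLinAlgEquiv' (matF l) :=
  congrArg (Matrix.toLinAlgEquiv' (R := ℂ) (n := Fin l)) (DB.lift_F hd hζ _)
theorem simpleMod_K : (simpleMod hd hζ hl1 hl2 p).ρ (DB.K hd hζ)
    = Matrix.toLinAlgEquiv' (matK ζ l p.val) :=
  congrArg (Matrix.toLinAlgEquiv' (R := ℂ) (n := Fin l)) (DB.lift_K hd hζ _)
theorem simpleMod_z : (simpleMod hd hζ hl1 hl2 p).ρ (DB.z hd hζ)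
    = Matrix.toLinAlgEquiv' (matZ ζ l p.val) :=
  congrArg (Matrix.toLinAlgEquiv' (R := ℂ) (n := Fin l)) (DB.lift_z hd hζ _)

/-- The standard basis vector `e_{i+1}` of `M_{l,p}`. -/
noncomputable def basisVec (i : Fin l) : (simpleMod hd hζ hl1 hl2 p).V :=
  (Pi.single i 1 : Fin l → ℂ)

theorem K_basisVec (i : Fin l) :
    (simpleMod hd hζ hl1 hl2 p).ρ (DB.K hd hζ) (basisVec hd hζ hl1 hl2 p i)
      = ζ ^ (p.val + (l - 1 - i.val)) • basisVec hd hζ hl1 hl2 p i := by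
  rw [simpleMod_K]
  have h : (matK ζ l p.val).mulVec (Pi.single i 1)
      = ζ ^ (p.val + (l - 1 - i.val)) • (Pi.single i 1 : Fin l → ℂ) := by
    rw [matK, Matrix.smul_mulVec, Matrix.diagonal_mulVec_single, pow_add, mul_smul, ← smul_eq_mul,
      Pi.single_smul]
  exact h

theorem z_apply (v : (simpleMod hd hζ hl1 hl2 p).V) :
    (simpleMod hd hζ hl1 hl2 p).ρ (DB.z hd hζ) v = ζ ^ (2 * p.val + l - 1) • v := by
  rw [simpleMod_z]
  have h : ∀ w : Fin l → ℂ, (matZ ζ l p.val).mulVec w = ζ ^ (2 * p.val + l - 1) • w := fun w => by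
    rw [matZ, Matrix.smul_mulVec, Matrix.one_mulVec]
  exact h v

/-- The exponent is kept natural by writing `z⁻¹` as `z^(d-1)`; modulo `d` it is the exponent of `K`
minus `2p + l - 1`. -/
theorem Kstar_basisVec (i : Fin l) :
    (simpleMod hd hζ hl1 hl2 p).ρ (DB.Kstar hd hζ) (basisVec hd hζ hl1 hl2 p i)
      = ζ ^ (p.val + (l - 1 - i.val) + (2 * p.val + l - 1) * (d - 1))
        • basisVec hd hζ hl1 hl2 p i := by
  rw [DB.Kstar, map_mul, Module.End.mul_apply, DB.zinv, map_pow,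
    DB.pow_apply_eigen (z_apply hd hζ hl1 hl2 p _), map_smul, K_basisVec, smul_smul, ← pow_mul,
    ← pow_add, add_comm]

theorem E_basisVec_zero (i : Fin l) (hi : i.val = 0) :
    (simpleMod hd hζ hl1 hl2 p).ρ (DB.E hd hζ) (basisVec hd hζ hl1 hl2 p i) = 0 := by
  rw [simpleMod_E]
  change (matE ζ l p.val).mulVec (Pi.single i 1) = 0
  ext j
  simp [matE, hi]

theorem F_basisVec_last (i : Fin l) (hi : i.val + 1 = l) :
    (simpleMod hd hζ hl1 hl2 p).ρ (DB.F hd hζ) (basisVec hd hζ hl1 hl2 p i) = 0 := by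
  rw [simpleMod_F]
  change (matF l).mulVec (Pi.single i 1) = 0
  ext j
  have : j.val ≠ i.val + 1 := by omega
  simp [matF, this]

theorem simpleMod_eq_smul_id {c : DB hd hζ} (hK : c * DB.K hd hζ = DB.K hd hζ * c)
    (hF : c * DB.F hd hζ = DB.F hd hζ * c) (i : Fin l) (x : ℂ)
    (hx : (simpleMod hd hζ hl1 hl2 p).ρ c (basisVec hd hζ hl1 hl2 p i)
      = x • basisVec hd hζ hl1 hl2 p i) :
    (simpleMod hd hζ hl1 hl2 p).ρ c = x • LinearMap.id := by
  refine eq_smul_id_of_commute hζ hl2 p.val _ ?_ ?_ i x hx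
  · have h := congrArg (simpleMod hd hζ hl1 hl2 p).ρ hK
    rw [map_mul, map_mul, simpleMod_K] at h
    exact h
  · have h := congrArg (simpleMod hd hζ hl1 hl2 p).ρ hF
    rw [map_mul, map_mul, simpleMod_F] at h
    exact h

theorem sPlus_simpleMod (M : FDMod (DB hd hζ)) :
    sPlus (DB.Rmat hd hζ) (DB.pivot hd hζ) (simpleMod hd hζ hl1 hl2 p) (Groth.cls M)
      = DB.χ hd hζ (-((l : ZMod d), p)) (Groth.cls M) • LinearMap.id := by
  have : NeZero d := ⟨by omega⟩
  have hT := M.tr_mul_comm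
  have hd1 : ((d - 1 : ℕ) : ZMod d) = -1 := by
    rw [Nat.cast_sub (by omega)]; simp
  have hl : ((l - 1 : ℕ) : ZMod d) = l - 1 := by rw [Nat.cast_sub hl1, Nat.cast_one]
  have hs : ((2 * p.val + l - 1 : ℕ) : ZMod d) = 2 * p + l - 1 := by
    rw [Nat.cast_sub (by omega)]; simp
  rw [sPlus_cls, FDMod.doubleBraiding_eq, rightTr_act₂, DB.pivot_val]
  -- Evaluation at index `0`, that is at `e_1`, which `E` kills.
  refine simpleMod_eq_smul_id hd hζ hl1 hl2 p ?_ (DB.contractRight_pivot_F hd hζ _ hT)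
    ⟨0, hl1⟩ _ ?_
  · have h := DB.contractRight_mul_K hd hζ (q := 1)
      (U := M.tr ∘ₗ LinearMap.mulLeft ℂ (DB.zinv hd hζ * DB.K hd hζ)) (fun b => by
        rw [one_mul]
        exact DB.trace_pivot_conj hd hζ _ hT b)
    rwa [one_smul] at h
  · refine (DB.contractRight_monodromy_apply hd hζ _ _ (E_basisVec_zero hd hζ hl1 hl2 p _ rfl)
      (K_basisVec hd hζ hl1 hl2 p _) (Kstar_basisVec hd hζ hl1 hl2 p _) ?_).trans ?_
    · intro i j hi hid
      refine DB.trace_eq_zero_of_weight hd hζ _ hT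
        (hζ.pow_ne_one_of_pos_of_lt (by omega) hid) ?_
      have hc : ∀ k, DB.K hd hζ * DB.Kstar hd hζ ^ k = DB.Kstar hd hζ ^ k * DB.K hd hζ := fun k =>
        (Commute.pow_right (DB.K_Kstar hd hζ) k).eq
      rw [LinearMap.mulLeft_apply, ← mul_assoc, DB.K_mul_pivot, mul_assoc _ (DB.K hd hζ),
        ← mul_assoc (DB.K hd hζ) (DB.E hd hζ ^ i * _), DB.E_pow_mul_K_pow_K, smul_mul_assoc,
        mul_assoc _ (DB.K hd hζ) (DB.Kstar hd hζ ^ _), hc, mul_smul_comm]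
      simp only [mul_assoc]
    · congr 1
      rw [LinearMap.comp_apply, LinearMap.mulLeft_apply, DB.χ, Groth.traceChar_cls]
      -- On `e_1`, modulo `d`, `a = p + l - 1` and `b = -p`. Thus `1 + a + b = l`, and the exponents
      -- of `K` and `z` are `-l` and `-p`.
      refine DB.trace_pivot_mul hd hζ M.tr hT ?_ ?_
      · push_cast
        rw [hd1, Nat.sub_zero, hl, hs]
        simp
        ring
      · push_cast
        rw [hd1, Nat.sub_zero, hl, hs]
        simp
        ring

theorem sMinus_simpleMod (M : FDMod (DB hd hζ)) :
    sMinus (DB.Rmat hd hζ) (DB.pivot hd hζ) (simpleMod hd hζ hl1 hl2 p) (Groth.cls M)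
      = DB.χ hd hζ ((0, 1) - ((l : ZMod d), p)) (Groth.cls M) • LinearMap.id := by
  have : NeZero d := ⟨by omega⟩
  have hT := M.tr_mul_comm
  have hd1 : ((d - 1 : ℕ) : ZMod d) = -1 := by
    rw [Nat.cast_sub (by omega)]; simp
  have hs : ((2 * p.val + l - 1 : ℕ) : ZMod d) = 2 * p + l - 1 := by
    rw [Nat.cast_sub (by omega)]; simp
  rw [sMinus_cls, FDMod.doubleBraiding_eq, leftTr_act₂, DB.pivot_inv]
  -- Evaluation at index `l - 1`, that is at `e_l`, which `F` kills.
  refine simpleMod_eq_smul_id hd hζ hl1 hl2 p ?_ (DB.contractLeft_pivot_F hd hζ _ hT)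
    ⟨l - 1, by omega⟩ _ ?_
  · exact DB.contractLeft_mul_K hd hζ (fun b => DB.trace_conj_pivot_inv hd hζ _ hT b)
  · refine (DB.contractLeft_monodromy_apply hd hζ _ _
      (F_basisVec_last hd hζ hl1 hl2 p _ (Nat.sub_add_cancel hl1))
      (K_basisVec hd hζ hl1 hl2 p _) (Kstar_basisVec hd hζ hl1 hl2 p _) ?_).trans ?_
    · intro i j hi hid
      have hq : ζ⁻¹ ^ i ≠ 1 := by
        rw [inv_pow, Ne, inv_eq_one]
        exact hζ.pow_ne_one_of_pos_of_lt hi hid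
      refine DB.trace_eq_zero_of_weight hd hζ _ hT hq ?_
      have hc : DB.K hd hζ * (DB.z hd hζ * DB.Kinv hd hζ) = DB.z hd hζ * DB.Kinv hd hζ * DB.K hd hζ := by
        rw [← mul_assoc, ← DB.zK, mul_assoc, mul_assoc, DB.K_Kinv_comm]
      rw [LinearMap.mulRight_apply, ← mul_assoc (DB.K hd hζ) (DB.dualBasis hd hζ i j * _),
        ← mul_assoc (DB.K hd hζ) (DB.dualBasis hd hζ i j), DB.dualBasis_K, smul_mul_assoc,
        smul_mul_assoc, mul_assoc _ (DB.K hd hζ) (DB.K hd hζ ^ _), ← pow_mul_comm',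
        ← mul_assoc (DB.dualBasis hd hζ i j),
        mul_assoc _ (DB.K hd hζ) (DB.z hd hζ * DB.Kinv hd hζ), hc]
      simp only [mul_assoc]
    · congr 1
      -- On `e_l`, modulo `d`, `a = p` and `b = 1 - l - p`. The exponents `a + b - 1 = -l` of `K`
      -- and `1 - a = 1 - p` of `z` are already the required ones, so the symmetry of traces plays
      -- no part.
      rw [LinearMap.comp_apply, LinearMap.mulRight_apply, DB.χ, Groth.traceChar_cls,
        DB.mul_pivot_inv hd hζ]
      · rfl
      · push_cast
        rw [hd1, hs]
        simp
        ring
      · push_cast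
        simp

end SimpleAction
end DrinfeldTaft

theorem mainTheorem4 {d : ℕ} (hd : 2 ≤ d) {ζ : ℂ} (hζ : IsPrimitiveRoot ζ d)
    (μ : ZMod d × ZMod d) :
    (∀ x : DrinfeldTaft.Groth (DrinfeldTaft.DB hd hζ),
      DrinfeldTaft.sPlus (DrinfeldTaft.DB.Rmat hd hζ) (DrinfeldTaft.DB.pivot hd hζ)
          (DrinfeldTaft.M hd hζ μ) x
        = DrinfeldTaft.DB.χ hd hζ (-μ) x • LinearMap.id) ∧
    (∀ x : DrinfeldTaft.Groth (DrinfeldTaft.DB hd hζ),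
      DrinfeldTaft.sMinus (DrinfeldTaft.DB.Rmat hd hζ) (DrinfeldTaft.DB.pivot hd hζ)
          (DrinfeldTaft.M hd hζ μ) x
        = DrinfeldTaft.DB.χ hd hζ ((0, 1) - μ) x • LinearMap.id) := by
  -- The class `0` is represented by `d`, whose cast is again `0`; hence the formulas proved for a
  -- natural number `l` apply to `μ`. Both sides are additive, so classes of modules suffice.
  have hμ : μ = (((DrinfeldTaft.toIcc μ.1 : ℕ) : ZMod d), μ.2) :=
    Prod.ext (DrinfeldTaft.toIcc_cast hd μ.1).symm rfl
  refine ⟨fun x => ?_, fun x => ?_⟩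
  · induction x using DrinfeldTaft.Groth.induct with
    | hcls N =>
      have h := DrinfeldTaft.sPlus_simpleMod hd hζ (DrinfeldTaft.one_le_toIcc hd μ.1)
        (DrinfeldTaft.toIcc_le hd μ.1) μ.2 N
      rw [← hμ] at h
      exact h
    | hneg y hy => rw [map_neg, map_neg, hy, neg_smul]
    | hadd y w hy hw => rw [map_add, map_add, hy, hw, add_smul]
    | h0 => rw [map_zero, map_zero, zero_smul]
  · induction x using DrinfeldTaft.Groth.induct with
    | hcls N =>
      have h := DrinfeldTaft.sMinus_simpleMod hd hζ (DrinfeldTaft.one_le_toIcc hd μ.1)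
        (DrinfeldTaft.toIcc_le hd μ.1) μ.2 N
      rw [← hμ] at h
      exact h
    | hneg y hy => rw [map_neg, map_neg, hy, neg_smul]
    | hadd y w hy hw => rw [map_add, map_add, hy, hw, add_smul]
    | h0 => rw [map_zero, map_zero, zero_smul]
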